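/- Let $\alpha\in(1,2)$, $k\ge 1$ and $\gamma_1,\dots,\gamma_k>0$. Consider an urn with $k$ colours, each of which has three types $a,b,c$. Let $X_i^a(n),X_i^b(n),X_i^c(n)$ be the weights of the three types of colour $i$ after $n$ steps, with $X_i^a(0)=\gamma_i$ and $X_i^b(0)=X_i^c(0)=0$ for $1\le i\le k$. At each step, given the past, a colour together with a type is drawn with probability proportional to its current weight in the urn. If colour $i$ type $a$ is drawn, weight $\alpha-1$ is added to type $a$, weight $2-\alpha$ to type $b$ and weight $\alpha-1$ to type $c$ of colour $i$. If colour $i$ type $b$ is drawn, weight $1$ is added to type $b$ and weight $\alpha-1$ to type $c$ of colour $i$. If colour $i$ type $c$ is drawn, weight $\alpha$ is added to type $c$ of colour $i$. For $a_1,\dots,a_k>0$, let $\mathrm{Dir}(a_1,\dots,a_k)$ be the law with density $\frac{\Gamma(\sum_i a_i)}{\prod_i\Gamma(a_i)}\prod_i x_i^{a_i-1}$ with respect to Lebesgue measure (in the first $k-1$ coordinates) on $\{x\in[0,1]^k:\sum_i x_i=1\}$. For $0<\beta<1$ and $\theta>-\beta$, let $\mathrm{ML}(\beta,\theta)$ be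 the law of a nonnegative random variable $M$ such that $\mathbb E[f(M)]=\mathbb E[\sigma_\beta^{-\theta}f(\sigma_\beta^{-\beta})]/\mathbb E[\sigma_\beta^{-\theta}]$ for all measurable $f\ge 0$, where $\sigma_\beta\ge 0$ has Laplace transform $\mathbb E[e^{-\lambda\sigma_\beta}]=e^{-\lambda^\beta}$, $\lambda\ge 0$. Then there are random vectors $(D_1,\dots,D_k)$, $(R_1,\dots,R_k)$ and $(\bar R_1,\dots,\bar R_k)$, defined on the same probability space as the urn, such that almost surely, as $n\to\infty$, \begin{align*} \frac{1}{(\alpha-1)n^{1-1/\alpha}}\bigl(X_1^a(n),\dots,X_k^a(n)\bigr)&\to\bigl(D_1^{1-1/\alpha}R_1^{\alpha-1}\bar R_1,\dots,D_k^{1-1/\alpha}R_k^{\alpha-1}\bar R_k\bigr),\\ \frac{1}{n^{1/\alpha}}\bigl(X_1^b(n),\dots,X_k^b(n)\bigr)&\to\bigl(D_1^{1/\alpha}R_1,\dots,D_k^{1/\alpha}R_k\bigr),\\ \frac{1}{\alpha n}\bigl(X_1^c(n),\dots,X_k^c(n)\bigr)&\to(D_1,\dots,D_k). \end{align*} Here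 the three vectors are independent; $(D_1,\dots,D_k)\sim\mathrm{Dir}(\gamma_1/\alpha,\dots,\gamma_k/\alpha)$; the variables $R_1,\dots,R_k$ are mutually independent with $R_i\sim\mathrm{ML}(1/\alpha,\gamma_i/\alpha)$; and the variables $\bar R_1,\dots,\bar R_k$ are mutually independent with $\bar R_i\sim\mathrm{ML}(\alpha-1,\gamma_i)$. -/

import Mathlib

open MeasureTheory ProbabilityTheory Filter Topology
open scoped ENNReal

/-- The three types that each colour of the urn comes in. -/
inductive UrnType
  | a
  | b
  | c
  deriving DecidableEq

instance : Fintype UrnType where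
  elems := {.a, .b, .c}
  complete := by intro x; cases x <;> simp

/-- `typeIncrement α s t` is the weight added to type `t` of a colour when
type `s` of that same colour is drawn. -/
def typeIncrement (α : ℝ) : UrnType → UrnType → ℝ
  | .a, .a => α - 1
  | .a, .b => 2 - α
  | .a, .c => α - 1
  | .b, .a => 0
  | .b, .b => 1
  | .b, .c => α - 1
  | .c, .a => 0
  | .c, .b => 0
  | .c, .c => α

/-- `X n ω i t` is the weight of type `t` of colour `i` in the urn after `n` steps and `draw n ω`
is the pair (colour, type) drawn in the step from time `n` to time `n + 1`. The urn starts from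
weight `γ i` on type `a` of each colour `i`. Conditionally on the past (the σ-algebra `ℱ n`, with
respect to which the weights up to time `n` are measurable), each pair (colour, type) is drawn
with probability proportional to its current weight. -/
structure IsThreeTypeUrn {Ω : Type*} [m : MeasurableSpace Ω] {k : ℕ} (α : ℝ) (γ : Fin k → ℝ)
    (μ : Measure Ω) (ℱ : Filtration ℕ m) (draw : ℕ → Ω → Fin k × UrnType)
    (X : ℕ → Ω → Fin k → UrnType → ℝ) : Prop where
  init_a : ∀ ω i, X 0 ω i .a = γ i
  init_b : ∀ ω i, X 0 ω i .b = 0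
  init_c : ∀ ω i, X 0 ω i .c = 0
  step : ∀ n ω i t, X (n + 1) ω i t =
    X n ω i t + if i = (draw n ω).1 then typeIncrement α (draw n ω).2 t else 0
  adapted : ∀ n i t, Measurable[ℱ n] fun ω => X n ω i t
  measurable_draw : ∀ n i t, MeasurableSet {ω | draw n ω = (i, t)}
  draw_prob : ∀ n i t, μ⟦{ω | draw n ω = (i, t)} | ℱ n⟧ =ᵐ[μ]
    fun ω => X n ω i t / ∑ j, ∑ s, X n ω j s

/-- Lebesgue measure on the simplex `{x ∈ [0,1]ⁿ : ∑ i, x i = 1}`, that is, Lebesgue measure in the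
first `n - 1` coordinates, the last coordinate being `1` minus their sum. -/
noncomputable def simplexLebesgue : (n : ℕ) → Measure (Fin n → ℝ)
  | 0 => 0
  | n + 1 => Measure.map (fun x : Fin n → ℝ => (Fin.snoc x (1 - ∑ i, x i) : Fin (n + 1) → ℝ))
      (volume.restrict {x : Fin n → ℝ | (∀ i, 0 ≤ x i) ∧ ∑ i, x i ≤ 1})

/-- The Dirichlet distribution `Dir(a₁, …, aₙ)`, for `n ≥ 1` and positive parameters. -/
noncomputable def dirichletMeasure {n : ℕ} (a : Fin n → ℝ) : Measure (Fin n → ℝ) :=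
  (simplexLebesgue n).withDensity fun x =>
    ENNReal.ofReal (Real.Gamma (∑ i, a i) / (∏ i, Real.Gamma (a i)) * ∏ i, x i ^ (a i - 1))

/-- `ν` is the law of the positive stable random variable `σ` of index `β ∈ (0,1)`, i.e. `σ ≥ 0`
and `𝔼[exp(-l σ)] = exp(-l ^ β)` for `l ≥ 0`. -/
structure IsPositiveStableLaw (β : ℝ) (ν : Measure ℝ) : Prop where
  isProbabilityMeasure : IsProbabilityMeasure ν
  nonneg : ∀ᵐ x ∂ν, 0 ≤ x
  laplace : ∀ l : ℝ, 0 ≤ l → ∫ x, Real.exp (-(l * x)) ∂ν = Real.exp (-(l ^ β))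

/-- `ρ` is the generalized Mittag-Leffler distribution `ML(β, θ)` (for `0 < β < 1`, `θ > -β`):
if `M` has law `ρ` then `𝔼[f(M)] = 𝔼[σ ^ (-θ) f(σ ^ (-β))] / 𝔼[σ ^ (-θ)]` for every nonnegative
measurable `f`, where `σ` is positive stable of index `β`. -/
def IsMittagLefflerLaw (β θ : ℝ) (ρ : Measure ℝ) : Prop :=
  ∃ ν : Measure ℝ, IsPositiveStableLaw β ν ∧
    ∀ f : ℝ → ℝ≥0∞, Measurable f →
      ∫⁻ y, f y ∂ρ =
        (∫⁻ x, ENNReal.ofReal (x ^ (-θ)) * f (x ^ (-β)) ∂ν) / ∫⁻ x, ENNReal.ofReal (x ^ (-θ)) ∂ν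

/-! For each colour let N be the number of its draws, K the number of those of type `a` or `b`, and
J the number of those of type `a`. With γ the initial weight, the weights are γ + (α - 1)J for `a`,
γ + K for `a` and `b` together, and γ + αN for the whole colour. The urn is thus a nest of
Pólya-like choices: between colours, then `c` against the rest, then `b` against `a`.

This nesting yields a positive martingale for all real exponents p, q, r in an open range around 0:
a product of ratios of rising factorials which behaves like D^p R^q R̄^r up to a constant, where D,
R, R̄ are the limits of N/n, K/N^(1/α) and J/K^(α-1) (`sum_colourWeight_mul_urnPotential`,
`IsThreeTypeUrn.martingale_of_harmonic`). Positive martingales converge. A positive and a negative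
exponent together force the three quotients to have strictly positive limits
(`exists_tendsto_div_rpow_of_risingRatio`). For σ > 1 near 1, the σ-th power of such a martingale is
bounded by a multiple of the martingale with exponents σp, σq, σr, whose mean is 1. So each
martingale is bounded in some Lˢ with s > 1, and its limit has mean 1.

Hence the joint moments of (D, R, R̄) are explicit quotients of Gamma values. They factor into a
Dirichlet moment and one Mittag-Leffler moment for each R and R̄
(`IsThreeTypeUrn.lintegral_prod_limits`). Moments of real order near 0 determine a positive random
vector, through the characteristic function of its logarithm
(`map_eq_map_of_lintegral_prod_rpow_eq`), so the joint law is a product with the stated Dirichlet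
factor.

Since a Mittag-Leffler law is defined through a stable law, that stable law has to be produced. It
is the image of the tilted law under x ↦ x^(-1/β), and its Laplace transform is found by multiplying
with an independent exponential variable (`isMittagLefflerLaw_of_moments`). -/

/-- The ratio of rising factorials `(x + q)(x + q + 1)⋯(x + q + n - 1) / (x(x + 1)⋯(x + n - 1))`. -/
noncomputable def risingRatio (x q : ℝ) (n : ℕ) : ℝ :=
  ∏ l ∈ Finset.range n, (x + q + l) / (x + l)

/-! ### Asymptotics of ratios of rising factorials -/

section RisingRatio

variable {x q : ℝ}

@[simp] lemma risingRatio_zero (x q : ℝ) : risingRatio x q 0 = 1 := by simp [risingRatio]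

lemma risingRatio_succ (x q : ℝ) (n : ℕ) :
    risingRatio x q (n + 1) = risingRatio x q n * ((x + q + n) / (x + n)) :=
  Finset.prod_range_succ _ _

lemma risingRatio_pos (hx : 0 < x) (hq : 0 < x + q) (n : ℕ) : 0 < risingRatio x q n :=
  Finset.prod_pos fun _ _ => by positivity

lemma risingRatio_zero_right (hx : 0 < x) (n : ℕ) : risingRatio x 0 n = 1 := by
  refine Finset.prod_eq_one fun l _ => ?_
  rw [add_zero, div_self]; positivity

lemma risingRatio_one_right (hx : 0 < x) (n : ℕ) : risingRatio x 1 n = (x + n) / x := by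
  induction n with
  | zero => simp [hx.ne']
  | succ n ih =>
    rw [risingRatio_succ, ih]
    have : x + n ≠ 0 := by positivity
    push_cast
    field_simp
    ring

/-- Quotient of Euler's product formulas for Γ at x and at x + q. `Real.GammaSeq` has n + 1 factors
in its denominator, one more than `risingRatio`; the surplus quotient tends to 1. -/
lemma tendsto_risingRatio (hx : 0 < x) (hq : 0 < x + q) :
    Tendsto (fun n : ℕ => risingRatio x q n / (n : ℝ) ^ q) atTop
      (𝓝 (Real.Gamma x / Real.Gamma (x + q))) := by
  have h1 := (Real.GammaSeq_tendsto_Gamma x).div (Real.GammaSeq_tendsto_Gamma (x + q))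
    (Real.Gamma_pos_of_pos hq).ne'
  have h2 : Tendsto (fun n : ℕ => (x + n) / (x + q + n)) atTop (𝓝 1) := by
    have ha : Tendsto (fun n : ℕ => q / (x + q + n)) atTop (𝓝 0) :=
      tendsto_const_nhds.div_atTop
        (tendsto_atTop_add_const_left _ _ tendsto_natCast_atTop_atTop)
    have := (tendsto_const_nhds (x := (1 : ℝ))).sub ha
    rw [sub_zero] at this
    refine this.congr fun n => ?_
    have : x + q + n ≠ 0 := by positivity
    field_simp
    ring
  have h3 := h1.mul h2
  rw [mul_one] at h3
  refine h3.congr' ?_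
  filter_upwards [eventually_gt_atTop 0] with n hn
  have hn' : (0 : ℝ) < n := by exact_mod_cast hn
  have key : risingRatio x q n * ((x + q + n) / (x + n)) =
      (∏ j ∈ Finset.range (n + 1), (x + q + j)) / ∏ j ∈ Finset.range (n + 1), (x + j) := by
    rw [← risingRatio_succ, risingRatio, Finset.prod_div_distrib]
  have hp1 : (∏ j ∈ Finset.range (n + 1), (x + j)) ≠ 0 :=
    (Finset.prod_pos fun _ _ => by positivity).ne'
  have hp2 : (∏ j ∈ Finset.range (n + 1), (x + q + j)) ≠ 0 :=
    (Finset.prod_pos fun _ _ => by positivity).ne'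
  have e1 : x + n ≠ 0 := by positivity
  have e2 : x + q + n ≠ 0 := by positivity
  have e3 : risingRatio x q n = (∏ j ∈ Finset.range (n + 1), (x + q + j)) /
      (∏ j ∈ Finset.range (n + 1), (x + j)) * ((x + n) / (x + q + n)) := by
    rw [← key]; field_simp
  rw [e3]
  simp only [Pi.div_apply, Real.GammaSeq]
  rw [Real.rpow_add hn']
  have hf : ((n.factorial : ℕ) : ℝ) ≠ 0 := by exact_mod_cast n.factorial_ne_zero
  have := (Real.rpow_pos_of_pos hn' x).ne'
  have := (Real.rpow_pos_of_pos hn' q).ne'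
  field_simp

lemma exists_bounds_of_tendsto_pos {f : ℕ → ℝ} {l : ℝ} (hf : ∀ n, 0 < f n) (hl : 0 < l)
    (h : Tendsto f atTop (𝓝 l)) : ∃ c C : ℝ, 0 < c ∧ 0 < C ∧ ∀ n, c ≤ f n ∧ f n ≤ C := by
  obtain ⟨C, hC⟩ := h.bddAbove_range
  obtain ⟨B, hB⟩ := (h.inv₀ hl.ne').bddAbove_range
  have hC' : ∀ n, f n ≤ C := fun n => hC ⟨n, rfl⟩
  have hB' : ∀ n, (f n)⁻¹ ≤ B := fun n => hB ⟨n, rfl⟩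
  have hB0 : 0 < B := (inv_pos.2 (hf 0)).trans_le (hB' 0)
  exact ⟨B⁻¹, C, inv_pos.2 hB0, (hf 0).trans_le (hC' 0), fun n =>
    ⟨inv_le_of_inv_le₀ (hf n) (hB' n), hC' n⟩⟩

/-- Taking n + 1 in place of n keeps the power positive at n = 0, so that the bounds hold for every
n. -/
lemma exists_bounds_risingRatio (hx : 0 < x) (hq : 0 < x + q) :
    ∃ c C : ℝ, 0 < c ∧ 0 < C ∧ ∀ n : ℕ, c * ((n : ℝ) + 1) ^ q ≤ risingRatio x q n ∧
      risingRatio x q n ≤ C * ((n : ℝ) + 1) ^ q := by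
  have h0 : Tendsto (fun n : ℕ => ((n : ℝ) / (n + 1)) ^ q) atTop (𝓝 (1 ^ q)) :=
    (tendsto_natCast_div_add_atTop (1 : ℝ)).rpow_const (Or.inl one_ne_zero)
  have h1 := (tendsto_risingRatio hx hq).mul h0
  rw [Real.one_rpow, mul_one] at h1
  have h2 : Tendsto (fun n : ℕ => risingRatio x q n / ((n : ℝ) + 1) ^ q) atTop
      (𝓝 (Real.Gamma x / Real.Gamma (x + q))) := by
    refine h1.congr' ?_
    filter_upwards [eventually_gt_atTop 0] with n hn
    have hn' : (0 : ℝ) < n := by exact_mod_cast hn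
    rw [Real.div_rpow hn'.le (by positivity)]
    have := (Real.rpow_pos_of_pos hn' q).ne'
    field_simp
  obtain ⟨c, C, hc, hC, h⟩ := exists_bounds_of_tendsto_pos
    (fun n => div_pos (risingRatio_pos hx hq n) (by positivity))
    (div_pos (Real.Gamma_pos_of_pos hx) (Real.Gamma_pos_of_pos hq)) h2
  refine ⟨c, C, hc, hC, fun n => ?_⟩
  have hp : 0 < ((n : ℝ) + 1) ^ q := by positivity
  exact ⟨(le_div_iff₀ hp).1 (h n).1, (div_le_iff₀ hp).1 (h n).2⟩

/-- The `s`-th power of a ratio of rising factorials is comparable to the ratio with `q` replaced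
by `s * q`. -/
lemma exists_bounds_risingRatio_rpow {s : ℝ} (hs : 0 < s) (hx : 0 < x) (hq : 0 < x + q)
    (hsq : 0 < x + s * q) :
    ∃ c C : ℝ, 0 < c ∧ 0 < C ∧ ∀ n : ℕ, c * risingRatio x (s * q) n ≤ risingRatio x q n ^ s ∧
      risingRatio x q n ^ s ≤ C * risingRatio x (s * q) n := by
  obtain ⟨c, C, hc, hC, h⟩ := exists_bounds_risingRatio hx hq
  obtain ⟨c', C', hc', hC', h'⟩ := exists_bounds_risingRatio hx hsq
  refine ⟨c ^ s / C', C ^ s / c', by positivity, by positivity, fun n => ?_⟩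
  have hp : (((n : ℝ) + 1) ^ q) ^ s = ((n : ℝ) + 1) ^ (s * q) := by
    rw [← Real.rpow_mul (by positivity), mul_comm]
  constructor
  · calc c ^ s / C' * risingRatio x (s * q) n
        ≤ c ^ s / C' * (C' * ((n : ℝ) + 1) ^ (s * q)) := by gcongr; exact (h' n).2
      _ = (c * ((n : ℝ) + 1) ^ q) ^ s := by
        rw [Real.mul_rpow hc.le (by positivity), hp]; field_simp
      _ ≤ risingRatio x q n ^ s := by
        refine Real.rpow_le_rpow (by positivity) (h n).1 hs.le
  · calc risingRatio x q n ^ s ≤ (C * ((n : ℝ) + 1) ^ q) ^ s :=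
          Real.rpow_le_rpow (risingRatio_pos hx hq n).le (h n).2 hs.le
      _ = C ^ s / c' * (c' * ((n : ℝ) + 1) ^ (s * q)) := by
        rw [Real.mul_rpow hC.le (by positivity), hp]; field_simp
      _ ≤ C ^ s / c' * risingRatio x (s * q) n := by gcongr; exact (h' n).1

lemma tendsto_risingRatio_comp (hx : 0 < x) (hq : 0 < x + q) {u : ℕ → ℕ} {v : ℕ → ℝ} {d : ℝ}
    (hu : Tendsto u atTop atTop) (hv : ∀ᶠ n in atTop, 0 < v n) (hd : 0 < d)
    (h : Tendsto (fun n => (u n : ℝ) / v n) atTop (𝓝 d)) :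
    Tendsto (fun n => risingRatio x q (u n) / v n ^ q) atTop
      (𝓝 (Real.Gamma x / Real.Gamma (x + q) * d ^ q)) := by
  refine (((tendsto_risingRatio hx hq).comp hu).mul
    (h.rpow_const (p := q) (Or.inl hd.ne'))).congr' ?_
  filter_upwards [hv, hu.eventually_gt_atTop 0] with n h1 h2
  have h2' : (0 : ℝ) < u n := by exact_mod_cast h2
  simp only [Function.comp]
  rw [Real.div_rpow h2'.le h1.le]
  have := (Real.rpow_pos_of_pos h2' q).ne'
  field_simp

/-- If the ratios of rising factorials of two integer sequences have finite limits both for a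
positive and for a negative exponent, then the sequences are asymptotically comparable. -/
lemma exists_tendsto_div_rpow_of_risingRatio {y e δ : ℝ} (hx : 0 < x) (hy : 0 < y) (he : 0 < e)
    (hδ : 0 < δ) (hδx : δ < x) (hδy : δ * e < y) {u v : ℕ → ℕ} (hv : Tendsto v atTop atTop)
    (h1 : ∃ l, Tendsto (fun n => risingRatio x 1 (u n) / risingRatio y e (v n)) atTop (𝓝 l))
    (h2 : ∃ l, Tendsto (fun n => risingRatio x (-δ) (u n) / risingRatio y (-(δ * e)) (v n)) atTop
      (𝓝 l)) :
    ∃ d, 0 < d ∧ Tendsto (fun n => (u n : ℝ) / (v n : ℝ) ^ e) atTop (𝓝 d) ∧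
      Tendsto u atTop atTop := by
  obtain ⟨l, h1⟩ := h1
  obtain ⟨l', h2⟩ := h2
  have hvR : Tendsto (fun n => (v n : ℝ)) atTop atTop := tendsto_natCast_atTop_atTop.comp hv
  have hve : Tendsto (fun n => (v n : ℝ) ^ e) atTop atTop := (tendsto_rpow_atTop he).comp hvR
  have h3 := (tendsto_risingRatio hy (q := e) (by positivity)).comp hv
  -- At exponent 1 the ratio is affine in `u n`, so its convergence is that of u / v^e.
  have h4 : Tendsto (fun n => (u n : ℝ) / (v n : ℝ) ^ e) atTop
      (𝓝 (x * (l * (Real.Gamma y / Real.Gamma (y + e))))) := by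
    have h5 := ((h1.mul h3).const_mul x).sub (tendsto_const_nhds (x := x) |>.div_atTop hve)
    rw [sub_zero] at h5
    refine h5.congr' ?_
    filter_upwards [hvR.eventually_gt_atTop 0] with n hn
    have := (risingRatio_pos hy (q := e) (by positivity) (v n)).ne'
    have := (Real.rpow_pos_of_pos hn e).ne'
    simp only [Function.comp, risingRatio_one_right hx]
    field_simp
    ring
  set d := x * (l * (Real.Gamma y / Real.Gamma (y + e)))
  have hd0 : 0 ≤ d := ge_of_tendsto' h4 fun n => by positivity
  -- If d were 0, the ratio with exponent -δ would dominate a multiple of ((u + 1) / (v +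
  -- 1)^e)^(-δ), which tends to infinity, against `h2`.
  have hd : 0 < d := by
    refine hd0.lt_of_ne' fun hd => ?_
    rw [hd] at h4
    obtain ⟨c, _, hc, _, hcb⟩ := exists_bounds_risingRatio hx (q := -δ) (by linarith)
    obtain ⟨_, C, _, hC, hCb⟩ := exists_bounds_risingRatio hy (q := -(δ * e)) (by linarith)
    have h6 : Tendsto (fun n => ((u n : ℝ) + 1) / ((v n : ℝ) + 1) ^ e) atTop (𝓝 0) := by
      have h7 := h4.add (tendsto_const_nhds (x := (1 : ℝ)) |>.div_atTop hve)
      rw [add_zero] at h7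
      refine squeeze_zero' (Eventually.of_forall fun n => by positivity) ?_ h7
      filter_upwards [hvR.eventually_gt_atTop 0] with n hn
      rw [← add_div]
      gcongr
      linarith
    have h7 : Tendsto (fun n => c / C * (((u n : ℝ) + 1) / ((v n : ℝ) + 1) ^ e) ^ (-δ)) atTop
        atTop := by
      refine Tendsto.const_mul_atTop (by positivity) ?_
      have h8 : Tendsto (fun n => (((u n : ℝ) + 1) / ((v n : ℝ) + 1) ^ e)⁻¹) atTop atTop :=
        Tendsto.inv_tendsto_nhdsGT_zero (tendsto_nhdsWithin_iff.2
          ⟨h6, Eventually.of_forall fun n => by simp only [Set.mem_Ioi]; positivity⟩)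
      refine ((tendsto_rpow_atTop hδ).comp h8).congr fun n => ?_
      simp only [Function.comp]
      rw [Real.inv_rpow (by positivity), Real.rpow_neg (by positivity)]
    refine not_tendsto_nhds_of_tendsto_atTop (tendsto_atTop_mono (fun n => ?_) h7) _ h2
    have hy' := risingRatio_pos hy (q := -(δ * e)) (by linarith) (v n)
    calc c / C * (((u n : ℝ) + 1) / ((v n : ℝ) + 1) ^ e) ^ (-δ)
        = (c * ((u n : ℝ) + 1) ^ (-δ)) / (C * ((v n : ℝ) + 1) ^ (-(δ * e))) := by
          rw [Real.div_rpow (by positivity) (by positivity), ← Real.rpow_mul (by positivity)]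
          have : e * -δ = -(δ * e) := by ring
          rw [this]; field_simp
      _ ≤ _ := by
          gcongr
          · exact (risingRatio_pos hx (by linarith) _).le
          · exact (hcb _).1
          · exact (hCb _).2
  refine ⟨d, hd, h4, ?_⟩
  rw [← tendsto_natCast_atTop_iff (R := ℝ)]
  refine (h4.pos_mul_atTop hd hve).congr' ?_
  filter_upwards [hvR.eventually_gt_atTop 0] with n hn
  have := (Real.rpow_pos_of_pos hn e).ne'
  field_simp

end RisingRatio

/-! ### Draw counts and harmonic functions of the urn -/

/-- The increments of the number of draws, of the number of draws of type `a` or `b` and of the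
number of draws of type `a` when a given type is drawn. -/
def countIncrement : UrnType → ℕ × ℕ × ℕ
  | .a => (1, 1, 1)
  | .b => (1, 1, 0)
  | .c => (1, 0, 0)

/-- For each colour: the number of its draws among the first `n`, the number of its draws with
type `a` or `b`, and the number of its draws with type `a`. -/
def drawCounts {Ω : Type*} {k : ℕ} (draw : ℕ → Ω → Fin k × UrnType) :
    ℕ → Ω → Fin k → ℕ × ℕ × ℕ
  | 0 => fun _ _ => 0
  | n + 1 => fun ω => Function.update (drawCounts draw n ω) (draw n ω).1
      (drawCounts draw n ω (draw n ω).1 + countIncrement (draw n ω).2)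

/-- The weight of a type of a colour with initial weight `g` and given draw counts. -/
def colourWeight (α g : ℝ) (s : ℕ × ℕ × ℕ) : UrnType → ℝ
  | .a => g + (α - 1) * s.2.2
  | .b => s.2.1 - (α - 1) * s.2.2
  | .c => α * s.1 - s.2.1

lemma sum_urnType {M : Type*} [AddCommMonoid M] (f : UrnType → M) :
    ∑ t, f t = f .a + f .b + f .c := by
  have : (Finset.univ : Finset UrnType) = {.a, .b, .c} := rfl
  rw [this, Finset.sum_insert (by decide), Finset.sum_insert (by decide), Finset.sum_singleton,
    add_assoc]

/-- The contribution of a single colour to the martingale of an urn. -/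
noncomputable def colourPotential (α g p q r : ℝ) (s : ℕ × ℕ × ℕ) : ℝ :=
  risingRatio (g / α) p s.1 / risingRatio (g / α) (q / α) s.1 *
    (risingRatio g q s.2.1 / risingRatio g (r * (α - 1)) s.2.1) *
    risingRatio (g / (α - 1)) r s.2.2

/-- For any admissible exponents, this function of the draw counts is a martingale. -/
noncomputable def urnPotential {k : ℕ} (α : ℝ) (γ p q r : Fin k → ℝ) (n : ℕ)
    (s : Fin k → ℕ × ℕ × ℕ) : ℝ :=
  (∏ i, colourPotential α (γ i) (p i) (q i) (r i) (s i)) / risingRatio (∑ i, γ i / α) (∑ i, p i) n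

/-- The exponents for which the martingale of a colour is positive. -/
structure AdmissibleExponents (α g p q r : ℝ) : Prop where
  fst : 0 < g / α + p
  snd : 0 < g + q
  trd : 0 < g / (α - 1) + r

section Potential

variable {α g p q r : ℝ}

lemma AdmissibleExponents.snd' (h : AdmissibleExponents α g p q r) (hα : 1 < α) :
    0 < g / α + q / α := by
  rw [← add_div]
  have := h.snd
  positivity

lemma AdmissibleExponents.trd' (h : AdmissibleExponents α g p q r) (hα : 1 < α) :
    0 < g + r * (α - 1) := by
  have h1 : 0 < α - 1 := by linarith
  have := mul_pos h.trd h1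
  rwa [add_mul, div_mul_cancel₀ _ h1.ne'] at this

lemma colourPotential_pos (hα : 1 < α) (hg : 0 < g) (h : AdmissibleExponents α g p q r)
    (s : ℕ × ℕ × ℕ) : 0 < colourPotential α g p q r s := by
  have h1 : 0 < α - 1 := by linarith
  have hga : 0 < g / α := by positivity
  exact mul_pos (mul_pos (div_pos (risingRatio_pos hga h.fst _)
    (risingRatio_pos hga (h.snd' hα) _)) (div_pos (risingRatio_pos hg h.snd _)
    (risingRatio_pos hg (h.trd' hα) _))) (risingRatio_pos (by positivity) h.trd _)

/-- The sum telescopes from the inside. Put w = r(α - 1). Drawing `a` turns its weight into g + w +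
(α - 1)J, and adding the weight of `b` gives g + w + K. The factor in K turns this into g + q + K,
and adding the weight of `c` gives g + q + αN. The factor in N then leaves g + αp + αN. -/
lemma sum_colourWeight_mul_colourPotential (hα : 1 < α) (hg : 0 < g)
    (h : AdmissibleExponents α g p q r) (s : ℕ × ℕ × ℕ) :
    ∑ t, colourWeight α g s t * colourPotential α g p q r (s + countIncrement t) =
      (g + α * s.1 + α * p) * colourPotential α g p q r s := by
  obtain ⟨N, K, J⟩ := s
  have h1 : 0 < α - 1 := by linarith
  have hga : 0 < g / α := by positivity
  have hgb : 0 < g / (α - 1) := by positivity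
  have e1 : g / α + N ≠ 0 := by positivity
  have e2 : g / α + q / α + N ≠ 0 := by have := h.snd' hα; positivity
  have e3 : g + K ≠ 0 := by positivity
  have e4 : g + r * (α - 1) + K ≠ 0 := by have := h.trd' hα; positivity
  have e5 : g / (α - 1) + J ≠ 0 := by positivity
  -- Rescaled one-step factors, whose numerators and denominators are the partial sums of weights,
  -- so that they cancel.
  have s1 : (g / α + p + N) / (g / α + N) = (g + α * p + α * N) / (g + α * N) := by
    field_simp
  have s2 : (g / α + q / α + N) / (g / α + N) = (g + q + α * N) / (g + α * N) := by
    field_simp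
  have s3 : (g / (α - 1) + r + J) / (g / (α - 1) + J) =
      (g + r * (α - 1) + (α - 1) * J) / (g + (α - 1) * J) := by
    field_simp
  have f1 : g + α * N ≠ 0 := by positivity
  have f2 : g + q + α * N ≠ 0 := by have := h.snd; positivity
  have f3 : g + (α - 1) * J ≠ 0 := by positivity
  have f4 := (risingRatio_pos hga (h.snd' hα) N).ne'
  have f5 := (risingRatio_pos hg (h.trd' hα) K).ne'
  rw [sum_urnType]
  simp only [colourWeight, colourPotential, countIncrement, Prod.mk_add_mk, add_zero,
    risingRatio_succ, s1, s2, s3]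
  generalize r * (α - 1) = w at *
  generalize risingRatio (g / α) p N = A
  generalize risingRatio g q K = B
  generalize risingRatio (g / (α - 1)) r J = C
  generalize risingRatio (g / α) (q / α) N = D at *
  generalize risingRatio g w K = E at *
  field_simp
  ring

/-- Drawing colour i changes only the i-th factor of the product. The one-colour identities add up
to ∑ γ + αn + α ∑ p, which the extra factor of the denominator at time n + 1 compensates. -/
lemma sum_colourWeight_mul_urnPotential {k : ℕ} {γ p q r : Fin k → ℝ} (hα : 1 < α) (hk : 0 < k)
    (hγ : ∀ i, 0 < γ i) (h : ∀ i, AdmissibleExponents α (γ i) (p i) (q i) (r i)) (n : ℕ)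
    (s : Fin k → ℕ × ℕ × ℕ) (hs : ∑ i, (s i).1 = n) :
    ∑ i, ∑ t, colourWeight α (γ i) (s i) t *
      urnPotential α γ p q r (n + 1) (Function.update s i (s i + countIncrement t)) =
      (∑ i, γ i + α * n) * urnPotential α γ p q r n s := by
  have : Nonempty (Fin k) := ⟨⟨0, hk⟩⟩
  have hA : 0 < ∑ i, γ i / α :=
    Finset.sum_pos (fun i _ => div_pos (hγ i) (by linarith)) Finset.univ_nonempty
  have hP : 0 < ∑ i, γ i / α + ∑ i, p i := by
    rw [← Finset.sum_add_distrib]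
    exact Finset.sum_pos (fun i _ => (h i).fst) Finset.univ_nonempty
  have hρ := (risingRatio_pos hA hP n).ne'
  have hα0 : α ≠ 0 := by linarith
  have hγα : ∑ i, γ i = α * ∑ i, γ i / α := by
    rw [Finset.mul_sum]; exact Finset.sum_congr rfl fun i _ => by field_simp
  have key : ∀ i, ∑ t, colourWeight α (γ i) (s i) t *
      (∏ j, colourPotential α (γ j) (p j) (q j) (r j)
        (Function.update s i (s i + countIncrement t) j)) =
      (γ i + α * (s i).1 + α * p i) * ∏ j, colourPotential α (γ j) (p j) (q j) (r j) (s j) := by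
    intro i
    rw [← Finset.mul_prod_erase Finset.univ (fun j => colourPotential α (γ j) (p j) (q j) (r j)
      (s j)) (Finset.mem_univ i), ← mul_assoc, ← sum_colourWeight_mul_colourPotential hα (hγ i)
      (h i) (s i), Finset.sum_mul]
    refine Finset.sum_congr rfl fun t _ => ?_
    rw [← Finset.mul_prod_erase Finset.univ _ (Finset.mem_univ i), Function.update_self, mul_assoc]
    congr 2
    refine Finset.prod_congr rfl fun j hj => ?_
    rw [Function.update_of_ne (Finset.ne_of_mem_erase hj)]
  simp only [urnPotential, mul_div_assoc', ← Finset.sum_div, key, ← Finset.sum_mul,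
    Finset.sum_add_distrib, ← Finset.mul_sum, risingRatio_succ]
  rw [hγα]
  have hsn : ∑ i, ((s i).1 : ℝ) = n := by exact_mod_cast hs
  rw [hsn]
  have e1 : ∑ i, γ i / α + n ≠ 0 := by positivity
  have e2 : ∑ i, γ i / α + ∑ i, p i + n ≠ 0 := by positivity
  field_simp
  ring

end Potential

section DrawCounts

variable {Ω : Type*} {k : ℕ}

lemma sum_drawCounts (draw : ℕ → Ω → Fin k × UrnType) (n : ℕ) (ω : Ω) :
    ∑ i, (drawCounts draw n ω i).1 = n := by
  induction n with
  | zero => simp [drawCounts]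
  | succ n ih =>
    simp only [drawCounts]
    rw [← Finset.add_sum_erase Finset.univ _ (Finset.mem_univ (draw n ω).1), Function.update_self]
    have : ∀ t, (countIncrement t).1 = 1 := by intro t; cases t <;> rfl
    have hrest : ∀ j ∈ Finset.univ.erase (draw n ω).1, (Function.update (drawCounts draw n ω)
        (draw n ω).1 (drawCounts draw n ω (draw n ω).1 + countIncrement (draw n ω).2) j).1 =
        (drawCounts draw n ω j).1 := fun j hj => by
      rw [Function.update_of_ne (Finset.ne_of_mem_erase hj)]
    rw [Prod.fst_add, this, add_right_comm, Finset.sum_congr rfl hrest,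
      Finset.add_sum_erase Finset.univ (fun j => (drawCounts draw n ω j).1) (Finset.mem_univ _), ih]

lemma drawCounts_mono (draw : ℕ → Ω → Fin k × UrnType) (n : ℕ) (ω : Ω) (i : Fin k) :
    (drawCounts draw n ω i).2.2 ≤ (drawCounts draw n ω i).2.1 ∧
      (drawCounts draw n ω i).2.1 ≤ (drawCounts draw n ω i).1 := by
  induction n with
  | zero => simp [drawCounts]
  | succ n ih =>
    simp only [drawCounts]
    by_cases hi : i = (draw n ω).1
    · subst hi
      rw [Function.update_self]
      cases (draw n ω).2 <;> simp [countIncrement] <;> omega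
    · rw [Function.update_of_ne hi]; exact ih

/-- At a fixed time the counts take finitely many values, so every function of them is bounded. -/
lemma drawCounts_mem_Iic (draw : ℕ → Ω → Fin k × UrnType) (n : ℕ) (ω : Ω) :
    drawCounts draw n ω ∈ Set.Iic (fun _ => ((n, n, n) : ℕ × ℕ × ℕ)) := by
  intro i
  have h := drawCounts_mono draw n ω i
  have h1 : (drawCounts draw n ω i).1 ≤ n := by
    conv_rhs => rw [← sum_drawCounts draw n ω]
    exact Finset.single_le_sum (f := fun i => (drawCounts draw n ω i).1)
      (fun _ _ => Nat.zero_le _) (Finset.mem_univ i)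
  exact ⟨h1, by simp; omega, by simp; omega⟩

end DrawCounts

/-! ### Adaptedness of the counts and the martingale property -/

lemma measurable_nat_of_affine {Ω : Type*} {m : MeasurableSpace Ω} {f : Ω → ℕ} {g : Ω → ℝ}
    {a b : ℝ} (hb : b ≠ 0) (hg : Measurable g) (h : ∀ ω, g ω = a + b * f ω) : Measurable f := by
  have : f = fun ω => ⌊(g ω - a) / b⌋₊ := by
    ext ω
    rw [h, add_sub_cancel_left, mul_div_cancel_left₀ _ hb, Nat.floor_natCast]
  rw [this]
  exact Nat.measurable_floor.comp ((hg.sub_const a).div_const b)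

namespace IsThreeTypeUrn

variable {Ω : Type*} [m : MeasurableSpace Ω] {k : ℕ} {α : ℝ} {γ : Fin k → ℝ}
    {μ : Measure Ω} {ℱ : Filtration ℕ m} {draw : ℕ → Ω → Fin k × UrnType}
    {X : ℕ → Ω → Fin k → UrnType → ℝ}

lemma eq_colourWeight (hX : IsThreeTypeUrn α γ μ ℱ draw X) (n : ℕ) (ω : Ω) (i : Fin k)
    (t : UrnType) : X n ω i t = colourWeight α (γ i) (drawCounts draw n ω i) t := by
  induction n with
  | zero => cases t <;> simp [colourWeight, drawCounts, hX.init_a, hX.init_b, hX.init_c]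
  | succ n ih =>
    rw [hX.step, ih]
    simp only [drawCounts]
    by_cases hi : i = (draw n ω).1
    · subst hi
      rw [Function.update_self, if_pos rfl]
      cases (draw n ω).2 <;> cases t <;>
        simp [countIncrement, colourWeight, typeIncrement] <;> ring
    · rw [Function.update_of_ne hi, if_neg hi, add_zero]

lemma sum_eq (hX : IsThreeTypeUrn α γ μ ℱ draw X) (n : ℕ) (ω : Ω) :
    ∑ j, ∑ s, X n ω j s = ∑ i, γ i + α * n := by
  have : ∀ j, ∑ s, X n ω j s = γ j + α * (drawCounts draw n ω j).1 := by
    intro j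
    simp only [hX.eq_colourWeight, sum_urnType, colourWeight]
    ring
  simp only [this, Finset.sum_add_distrib, ← Finset.mul_sum]
  congr 2
  exact_mod_cast sum_drawCounts draw n ω

/-- Only the weights are assumed adapted, not the draws. Each count is recovered from an affine
combination of the weights. -/
lemma measurable_drawCounts (hX : IsThreeTypeUrn α γ μ ℱ draw X) (hα : 1 < α) (n : ℕ) :
    Measurable[ℱ n] (drawCounts draw n) := by
  refine @measurable_pi_lambda _ _ _ (ℱ n) _ _ fun i => ?_
  have ha := hX.adapted n i .a
  have hb := hX.adapted n i .b
  have hc := hX.adapted n i .c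
  refine Measurable.prodMk ?_ (Measurable.prodMk ?_ ?_)
  · refine measurable_nat_of_affine (a := γ i) (b := α) (by linarith) ((ha.add hb).add hc) ?_
    intro ω
    simp only [Pi.add_apply, hX.eq_colourWeight, colourWeight]; ring
  · refine measurable_nat_of_affine (a := γ i) (b := 1) one_ne_zero (ha.add hb) ?_
    intro ω
    simp only [Pi.add_apply, hX.eq_colourWeight, colourWeight]; ring
  · refine measurable_nat_of_affine (a := γ i) (b := α - 1) (by linarith) ha ?_
    intro ω
    simp only [hX.eq_colourWeight, colourWeight]

lemma stronglyMeasurable_comp_drawCounts (hX : IsThreeTypeUrn α γ μ ℱ draw X) (hα : 1 < α) (n : ℕ)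
    (G : (Fin k → ℕ × ℕ × ℕ) → ℝ) :
    StronglyMeasurable[ℱ n] fun ω => G (drawCounts draw n ω) :=
  (Measurable.comp (.of_discrete : Measurable G)
    (hX.measurable_drawCounts hα n)).stronglyMeasurable

lemma integrable_comp_drawCounts [IsFiniteMeasure μ] (hX : IsThreeTypeUrn α γ μ ℱ draw X)
    (hα : 1 < α) (n : ℕ) (G : (Fin k → ℕ × ℕ × ℕ) → ℝ) :
    Integrable (fun ω => G (drawCounts draw n ω)) μ := by
  obtain ⟨C, hC⟩ := ((Set.finite_Iic (fun _ : Fin k => ((n, n, n) : ℕ × ℕ × ℕ))).image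
    (fun s => ‖G s‖)).bddAbove
  refine Integrable.of_bound
    ((hX.stronglyMeasurable_comp_drawCounts hα n G).mono (ℱ.le n)).aestronglyMeasurable C
    (Eventually.of_forall fun ω => hC ⟨_, drawCounts_mem_Iic draw n ω, rfl⟩)

/-- A function of the time and of the draw counts that is harmonic for the transition probabilities
of the urn gives a martingale. -/
lemma martingale_of_harmonic [IsProbabilityMeasure μ] (hX : IsThreeTypeUrn α γ μ ℱ draw X)
    (hα : 1 < α) (hγ : 0 < ∑ i, γ i) (F : ℕ → (Fin k → ℕ × ℕ × ℕ) → ℝ)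
    (hF : ∀ n s, ∑ i, (s i).1 = n → ∑ i, ∑ t, colourWeight α (γ i) (s i) t *
      F (n + 1) (Function.update s i (s i + countIncrement t)) = (∑ i, γ i + α * n) * F n s) :
    Martingale (fun n ω => F n (drawCounts draw n ω)) ℱ μ := by
  classical
  refine martingale_nat (fun n => hX.stronglyMeasurable_comp_drawCounts hα n _)
    (fun n => hX.integrable_comp_drawCounts hα n _) fun n => ?_
  let G : Fin k × UrnType → Ω → ℝ := fun a ω => F (n + 1)
    (Function.update (drawCounts draw n ω) a.1 (drawCounts draw n ω a.1 + countIncrement a.2))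
  let I : Fin k × UrnType → Ω → ℝ := fun a => Set.indicator {ω | draw n ω = a} fun _ => (1 : ℝ)
  have hI : ∀ a, Integrable (I a) μ := fun a =>
    (integrable_const _).indicator (hX.measurable_draw n a.1 a.2)
  have hG : ∀ a, StronglyMeasurable[ℱ n] (G a) := fun a =>
    hX.stronglyMeasurable_comp_drawCounts hα n
      (fun s => F (n + 1) (Function.update s a.1 (s a.1 + countIncrement a.2)))
  have hGi : ∀ a, Integrable (G a) μ := fun a =>
    hX.integrable_comp_drawCounts hα n
      (fun s => F (n + 1) (Function.update s a.1 (s a.1 + countIncrement a.2)))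
  have hGI : ∀ a, Integrable (G a * I a) μ := by
    intro a
    have : G a * I a = Set.indicator {ω | draw n ω = a} (G a) := by
      ext ω
      by_cases h : draw n ω = a <;> simp [I, h]
    rw [this]
    exact (hGi a).indicator (hX.measurable_draw n a.1 a.2)
  -- Splitting according to the next draw writes the future value as a sum of terms known at time n
  -- times indicators of draws, whose conditional probabilities are given.
  have hdecomp : (fun ω => F (n + 1) (drawCounts draw (n + 1) ω)) = ∑ a, G a * I a := by
    ext ω
    rw [Finset.sum_apply, Finset.sum_eq_single (draw n ω)]
    · simp [G, I, drawCounts]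
    · intro a _ ha
      simp [I, ha.symm]
    · simp
  have hce : ∀ᵐ ω ∂μ, ∀ a, (μ[G a * I a | ℱ n]) ω =
      G a ω * (X n ω a.1 a.2 / (∑ i, γ i + α * n)) := by
    rw [ae_all_iff]
    intro a
    filter_upwards [condExp_mul_of_stronglyMeasurable_left (hG a) (hGI a) (hI a),
      hX.draw_prob n a.1 a.2] with ω h1 h2
    rw [h1, Pi.mul_apply, ← hX.sum_eq n ω]
    exact congrArg _ h2
  rw [hdecomp]
  filter_upwards [hce, condExp_finsetSum (s := Finset.univ) (fun a _ => hGI a) (ℱ n)]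
    with ω h1 h2
  rw [h2, Finset.sum_apply]
  simp only [h1, G]
  have hpos : 0 < ∑ i, γ i + α * n := by positivity
  rw [Fintype.sum_prod_type, ← mul_div_cancel_left₀ (F n _) hpos.ne',
    ← hF n _ (sum_drawCounts draw n ω), Finset.sum_div]
  refine Finset.sum_congr rfl fun i _ => ?_
  rw [Finset.sum_div]
  refine Finset.sum_congr rfl fun t _ => ?_
  simp only [hX.eq_colourWeight]
  ring

end IsThreeTypeUrn

/-! ### Bounds in Lˢ and the mean of the martingale limit -/

/-- Convergence of integrals under an `Lˢ` bound, `s > 1`. -/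
lemma lintegral_eq_of_tendsto_of_lintegral_rpow_le {Ω : Type*} [MeasurableSpace Ω] {μ : Measure Ω}
    [IsFiniteMeasure μ] {F : ℕ → Ω → ℝ≥0∞} {G : Ω → ℝ≥0∞} {c C : ℝ≥0∞} {s : ℝ} (hs : 1 < s)
    (hC : C ≠ ∞) (hF : ∀ n, Measurable (F n))
    (hlim : ∀ᵐ ω ∂μ, Tendsto (fun n => F n ω) atTop (𝓝 (G ω)))
    (hc : ∀ n, ∫⁻ ω, F n ω ∂μ = c) (hb : ∀ n, ∫⁻ ω, F n ω ^ s ∂μ ≤ C) :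
    ∫⁻ ω, G ω ∂μ = c := by
  apply le_antisymm
  -- The upper bound is Fatou's lemma. The lower bound below truncates at T and controls the excess
  -- by T^(1-s) times the s-th moment.
  · calc ∫⁻ ω, G ω ∂μ = ∫⁻ ω, liminf (fun n => F n ω) atTop ∂μ :=
          lintegral_congr_ae (hlim.mono fun ω h => h.liminf_eq.symm)
      _ ≤ liminf (fun n => ∫⁻ ω, F n ω ∂μ) atTop := lintegral_liminf_le hF
      _ = c := by simp [hc]
  · have key : ∀ T : ℕ, 0 < T → c ≤ ∫⁻ ω, G ω ∂μ + (T : ℝ≥0∞) ^ (1 - s) * C := by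
      intro T hT
      have hT0 : (T : ℝ≥0∞) ≠ 0 := by exact_mod_cast hT.ne'
      have hTt : (T : ℝ≥0∞) ≠ ∞ := ENNReal.natCast_ne_top T
      have hpt : ∀ x : ℝ≥0∞, x ≤ min x T + (T : ℝ≥0∞) ^ (1 - s) * x ^ s := by
        intro x
        rcases le_total x T with h | h
        · rw [min_eq_left h]; exact le_self_add
        · refine le_trans ?_ le_add_self
          have hx : x ^ s = x ^ (s - 1) * x := by
            conv_rhs => rw [← ENNReal.rpow_one x, ← ENNReal.rpow_mul, one_mul]
            rw [← ENNReal.rpow_add_of_nonneg _ _ (by linarith) zero_le_one]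
            simp
          calc x = (T : ℝ≥0∞) ^ (1 - s) * (T : ℝ≥0∞) ^ (s - 1) * x := by
                rw [← ENNReal.rpow_add _ _ hT0 hTt]; simp
            _ ≤ (T : ℝ≥0∞) ^ (1 - s) * (x ^ (s - 1) * x) := by
                rw [mul_assoc]; gcongr
            _ = _ := by rw [hx]
      have h1 : ∀ n, c ≤ ∫⁻ ω, min (F n ω) T ∂μ + (T : ℝ≥0∞) ^ (1 - s) * C := by
        intro n
        calc c = ∫⁻ ω, F n ω ∂μ := (hc n).symm
          _ ≤ ∫⁻ ω, (min (F n ω) T + (T : ℝ≥0∞) ^ (1 - s) * F n ω ^ s) ∂μ :=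
            lintegral_mono fun ω => hpt _
          _ = ∫⁻ ω, min (F n ω) T ∂μ + (T : ℝ≥0∞) ^ (1 - s) * ∫⁻ ω, F n ω ^ s ∂μ := by
            rw [lintegral_add_left ((hF n).min measurable_const),
              lintegral_const_mul _ ((hF n).pow_const s)]
          _ ≤ _ := by gcongr; exact hb n
      have h2 : Tendsto (fun n => ∫⁻ ω, min (F n ω) T ∂μ) atTop (𝓝 (∫⁻ ω, min (G ω) T ∂μ)) := by
        refine tendsto_lintegral_of_dominated_convergence (fun _ => (T : ℝ≥0∞))
          (fun n => (hF n).min measurable_const)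
          (fun n => Eventually.of_forall fun ω => min_le_right _ _) ?_ ?_
        · rw [lintegral_const]; exact ENNReal.mul_ne_top hTt (measure_ne_top _ _)
        · filter_upwards [hlim] with ω h using h.min tendsto_const_nhds
      refine (ge_of_tendsto' (h2.add_const _) h1).trans ?_
      gcongr
      exact min_le_left _ _
    have h3 : Tendsto (fun T : ℕ => (T : ℝ≥0∞) ^ (1 - s) * C) atTop (𝓝 (0 * C)) := by
      refine ENNReal.Tendsto.mul_const ?_ (Or.inr hC)
      have h4 : Tendsto (fun T : ℕ => ((T : ℝ≥0∞) ^ (s - 1))⁻¹) atTop (𝓝 (∞ ^ (s - 1))⁻¹) :=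
        ((ENNReal.continuous_rpow_const.tendsto _).comp ENNReal.tendsto_nat_nhds_top).inv
      rw [ENNReal.top_rpow_of_pos (by linarith), ENNReal.inv_top] at h4
      refine h4.congr fun T => ?_
      rw [← ENNReal.rpow_neg, neg_sub]
    have h5 := (tendsto_const_nhds (x := ∫⁻ ω, G ω ∂μ)).add h3
    rw [zero_mul, add_zero] at h5
    refine ge_of_tendsto h5 ?_
    filter_upwards [eventually_gt_atTop 0] with T hT using key T hT

section PotentialBounds

variable {k : ℕ} {α : ℝ} {γ p q r : Fin k → ℝ}

lemma sum_add_pos_of_admissible (hk : 0 < k)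
    (h : ∀ i, AdmissibleExponents α (γ i) (p i) (q i) (r i)) :
    0 < ∑ i, γ i / α + ∑ i, p i := by
  have : Nonempty (Fin k) := ⟨⟨0, hk⟩⟩
  rw [← Finset.sum_add_distrib]
  exact Finset.sum_pos (fun i _ => (h i).fst) Finset.univ_nonempty

lemma sum_div_pos (hk : 0 < k) (hα : 1 < α) (hγ : ∀ i, 0 < γ i) : 0 < ∑ i, γ i / α := by
  have : Nonempty (Fin k) := ⟨⟨0, hk⟩⟩
  exact Finset.sum_pos (fun i _ => div_pos (hγ i) (by linarith)) Finset.univ_nonempty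

lemma urnPotential_pos (hk : 0 < k) (hα : 1 < α) (hγ : ∀ i, 0 < γ i)
    (h : ∀ i, AdmissibleExponents α (γ i) (p i) (q i) (r i)) (n : ℕ) (s : Fin k → ℕ × ℕ × ℕ) :
    0 < urnPotential α γ p q r n s :=
  div_pos (Finset.prod_pos fun i _ => colourPotential_pos hα (hγ i) (h i) _)
    (risingRatio_pos (sum_div_pos hk hα hγ) (sum_add_pos_of_admissible hk h) _)

/-- Each factor is comparable to a power of n + 1 whose exponent is linear in (p, q, r). Raising to
the power σ therefore amounts, up to constants, to multiplying the exponents by σ. -/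
lemma exists_colourPotential_rpow_le {σ g p q r : ℝ} (hσ : 0 < σ) (hα : 1 < α) (hg : 0 < g)
    (h : AdmissibleExponents α g p q r)
    (h' : AdmissibleExponents α g (σ * p) (σ * q) (σ * r)) :
    ∃ C, 0 < C ∧ ∀ s, colourPotential α g p q r s ^ σ ≤
      C * colourPotential α g (σ * p) (σ * q) (σ * r) s := by
  have h1 : 0 < α - 1 := by linarith
  have hga : 0 < g / α := by positivity
  have hgb : 0 < g / (α - 1) := by positivity
  have hq' := h'.snd' hα
  have hr' := h'.trd' hα
  rw [mul_div_assoc] at hq'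
  rw [mul_assoc] at hr'
  obtain ⟨_, C1, _, hC1, b1⟩ := exists_bounds_risingRatio_rpow hσ hga h.fst h'.fst
  obtain ⟨c2, _, hc2, _, b2⟩ := exists_bounds_risingRatio_rpow hσ hga (h.snd' hα) hq'
  obtain ⟨_, C3, _, hC3, b3⟩ := exists_bounds_risingRatio_rpow hσ hg h.snd h'.snd
  obtain ⟨c4, _, hc4, _, b4⟩ := exists_bounds_risingRatio_rpow hσ hg (h.trd' hα) hr'
  obtain ⟨_, C5, _, hC5, b5⟩ := exists_bounds_risingRatio_rpow hσ hgb h.trd h'.trd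
  refine ⟨C1 / c2 * (C3 / c4) * C5, by positivity, fun s => ?_⟩
  have p1 := risingRatio_pos hga h.fst s.1
  have p2 := risingRatio_pos hga (h.snd' hα) s.1
  have p3 := risingRatio_pos hg h.snd s.2.1
  have p4 := risingRatio_pos hg (h.trd' hα) s.2.1
  have p5 := risingRatio_pos hgb h.trd s.2.2
  have p1' := risingRatio_pos hga h'.fst s.1
  have p2' := risingRatio_pos hga hq' s.1
  have p3' := risingRatio_pos hg h'.snd s.2.1
  have p4' := risingRatio_pos hg hr' s.2.1
  have p5' := risingRatio_pos hgb h'.trd s.2.2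
  unfold colourPotential
  rw [mul_div_assoc σ q α, mul_assoc σ r, Real.mul_rpow (by positivity) p5.le,
    Real.mul_rpow (by positivity) (by positivity), Real.div_rpow p1.le p2.le,
    Real.div_rpow p3.le p4.le]
  calc _ ≤ (C1 * risingRatio (g / α) (σ * p) s.1) / (c2 * risingRatio (g / α) (σ * (q / α)) s.1) *
        ((C3 * risingRatio g (σ * q) s.2.1) / (c4 * risingRatio g (σ * (r * (α - 1))) s.2.1)) *
        (C5 * risingRatio (g / (α - 1)) (σ * r) s.2.2) := by
        gcongr
        · exact (b1 _).2
        · exact (b2 _).1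
        · exact (b3 _).2
        · exact (b4 _).1
        · exact (b5 _).2
    _ = _ := by field_simp

lemma exists_urnPotential_rpow_le {σ : ℝ} (hσ : 0 < σ) (hk : 0 < k) (hα : 1 < α)
    (hγ : ∀ i, 0 < γ i) (h : ∀ i, AdmissibleExponents α (γ i) (p i) (q i) (r i))
    (h' : ∀ i, AdmissibleExponents α (γ i) (σ * p i) (σ * q i) (σ * r i)) :
    ∃ C, 0 < C ∧ ∀ n s, urnPotential α γ p q r n s ^ σ ≤
      C * urnPotential α γ (fun i => σ * p i) (fun i => σ * q i) (fun i => σ * r i) n s := by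
  choose C hC hb using fun i => exists_colourPotential_rpow_le hσ hα (hγ i) (h i) (h' i)
  have hA := sum_div_pos hk hα hγ
  have hP' := sum_add_pos_of_admissible hk h'
  rw [← Finset.mul_sum] at hP'
  obtain ⟨c, _, hc, _, b⟩ := exists_bounds_risingRatio_rpow hσ hA
    (sum_add_pos_of_admissible hk h) hP'
  refine ⟨(∏ i, C i) / c, div_pos (Finset.prod_pos fun i _ => hC i) hc, fun n s => ?_⟩
  unfold urnPotential
  have hpos : ∀ i, 0 < colourPotential α (γ i) (p i) (q i) (r i) (s i) := fun i =>
    colourPotential_pos hα (hγ i) (h i) _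
  have hpos' := risingRatio_pos hA hP' n
  rw [Real.div_rpow (Finset.prod_pos fun i _ => hpos i).le
    (risingRatio_pos hA (sum_add_pos_of_admissible hk h) n).le,
    ← Real.finsetProd_rpow _ _ (fun i _ => (hpos i).le), ← Finset.mul_sum]
  calc _ ≤ (∏ i, C i * colourPotential α (γ i) (σ * p i) (σ * q i) (σ * r i) (s i)) /
        (c * risingRatio (∑ i, γ i / α) (σ * ∑ i, p i) n) := by
        have h0 : ∀ i, 0 ≤ C i * colourPotential α (γ i) (σ * p i) (σ * q i) (σ * r i) (s i) :=
          fun i => mul_nonneg (hC i).le (colourPotential_pos hα (hγ i) (h' i) _).le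
        refine div_le_div₀ (Finset.prod_nonneg fun i _ => h0 i) ?_ (by positivity) (b n).1
        exact Finset.prod_le_prod (fun i _ => Real.rpow_nonneg (hpos i).le _) fun i _ => hb i _
    _ = _ := by rw [Finset.prod_mul_distrib]; field_simp

/-- Admissibility consists of finitely many strict inequalities continuous in σ, so it persists
slightly beyond σ = 1. -/
lemma exists_one_lt_admissible (h : ∀ i, AdmissibleExponents α (γ i) (p i) (q i) (r i)) :
    ∃ σ : ℝ, 1 < σ ∧ ∀ i, AdmissibleExponents α (γ i) (σ * p i) (σ * q i) (σ * r i) := by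
  have aux : ∀ x y : ℝ, 0 < x + y → ∀ᶠ σ in 𝓝[>] (1 : ℝ), 0 < x + σ * y := by
    intro x y hxy
    have : Tendsto (fun σ : ℝ => x + σ * y) (𝓝 1) (𝓝 (x + 1 * y)) :=
      Continuous.tendsto (by fun_prop) 1
    rw [one_mul] at this
    exact (this.mono_left nhdsWithin_le_nhds).eventually_const_lt hxy
  have : ∀ᶠ σ in 𝓝[>] (1 : ℝ), ∀ i, AdmissibleExponents α (γ i) (σ * p i) (σ * q i) (σ * r i) := by
    rw [eventually_all]
    intro i
    filter_upwards [aux _ _ (h i).fst, aux _ _ (h i).snd, aux _ _ (h i).trd] with σ h1 h2 h3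
    exact ⟨h1, h2, h3⟩
  obtain ⟨σ, h1, h2⟩ := (this.and self_mem_nhdsWithin).exists
  exact ⟨σ, h2, h1⟩

end PotentialBounds

namespace IsThreeTypeUrn

variable {Ω : Type*} [m : MeasurableSpace Ω] {k : ℕ} {α : ℝ} {γ : Fin k → ℝ}
    {μ : Measure Ω} {ℱ : Filtration ℕ m}
    {draw : ℕ → Ω → Fin k × UrnType}
    {X : ℕ → Ω → Fin k → UrnType → ℝ} {p q r : Fin k → ℝ}

lemma measurable_urnPotential (hX : IsThreeTypeUrn α γ μ ℱ draw X) (hα : 1 < α) (n : ℕ) :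
    Measurable fun ω => urnPotential α γ p q r n (drawCounts draw n ω) :=
  ((hX.stronglyMeasurable_comp_drawCounts hα n _).mono (ℱ.le n)).measurable

variable [IsProbabilityMeasure μ]

lemma martingale_urnPotential (hX : IsThreeTypeUrn α γ μ ℱ draw X) (hk : 0 < k)
    (hα : 1 < α) (hγ : ∀ i, 0 < γ i)
    (h : ∀ i, AdmissibleExponents α (γ i) (p i) (q i) (r i)) :
    Martingale (fun n ω => urnPotential α γ p q r n (drawCounts draw n ω)) ℱ μ := by
  have : Nonempty (Fin k) := ⟨⟨0, hk⟩⟩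
  exact hX.martingale_of_harmonic hα (Finset.sum_pos (fun i _ => hγ i) Finset.univ_nonempty) _
    fun n s hs => sum_colourWeight_mul_urnPotential hα hk hγ h n s hs

/-- The mean is that of the initial value, where all products are empty and the martingale equals 1.
-/
lemma lintegral_urnPotential (hX : IsThreeTypeUrn α γ μ ℱ draw X) (hk : 0 < k)
    (hα : 1 < α) (hγ : ∀ i, 0 < γ i)
    (h : ∀ i, AdmissibleExponents α (γ i) (p i) (q i) (r i)) (n : ℕ) :
    ∫⁻ ω, ENNReal.ofReal (urnPotential α γ p q r n (drawCounts draw n ω)) ∂μ = 1 := by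
  have hM := hX.martingale_urnPotential hk hα hγ h
  rw [← ofReal_integral_eq_lintegral_ofReal (hM.integrable n)
    (Eventually.of_forall fun ω => (urnPotential_pos hk hα hγ h _ _).le)]
  have := hM.setIntegral_eq (Nat.zero_le n) MeasurableSet.univ
  simp only [Measure.restrict_univ] at this
  rw [← this]
  simp [urnPotential, colourPotential, drawCounts]

lemma ae_exists_tendsto_urnPotential (hX : IsThreeTypeUrn α γ μ ℱ draw X) (hk : 0 < k)
    (hα : 1 < α) (hγ : ∀ i, 0 < γ i)
    (h : ∀ i, AdmissibleExponents α (γ i) (p i) (q i) (r i)) :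
    ∀ᵐ ω ∂μ, ∃ l, Tendsto (fun n => urnPotential α γ p q r n (drawCounts draw n ω)) atTop
      (𝓝 l) := by
  refine (hX.martingale_urnPotential hk hα hγ h).submartingale.exists_ae_tendsto_of_bdd (R := 1)
    fun n => le_of_eq ?_
  rw [eLpNorm_one_eq_lintegral_enorm, ENNReal.coe_one, ← hX.lintegral_urnPotential hk hα hγ h n]
  refine lintegral_congr fun ω => ?_
  rw [Real.enorm_of_nonneg (urnPotential_pos hk hα hγ h _ _).le]

/-- The limit of the martingale of the urn has mean one. -/
lemma lintegral_of_tendsto_urnPotential (hX : IsThreeTypeUrn α γ μ ℱ draw X) (hk : 0 < k)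
    (hα : 1 < α) (hγ : ∀ i, 0 < γ i)
    (h : ∀ i, AdmissibleExponents α (γ i) (p i) (q i) (r i)) {G : Ω → ℝ}
    (hG : ∀ᵐ ω ∂μ, Tendsto (fun n => urnPotential α γ p q r n (drawCounts draw n ω)) atTop
      (𝓝 (G ω))) :
    ∫⁻ ω, ENNReal.ofReal (G ω) ∂μ = 1 := by
  obtain ⟨σ, hσ, h'⟩ := exists_one_lt_admissible h
  have hσ0 : 0 < σ := by linarith
  obtain ⟨C, hC, hb⟩ := exists_urnPotential_rpow_le hσ0 hk hα hγ h h'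
  refine lintegral_eq_of_tendsto_of_lintegral_rpow_le
    (F := fun n ω => ENNReal.ofReal (urnPotential α γ p q r n (drawCounts draw n ω)))
    (C := ENNReal.ofReal C) hσ ENNReal.ofReal_ne_top
    (fun n => (hX.measurable_urnPotential hα n).ennreal_ofReal) ?_
    (hX.lintegral_urnPotential hk hα hγ h) fun n => ?_
  · filter_upwards [hG] with ω hω using (ENNReal.continuous_ofReal.tendsto _).comp hω
  · calc _ ≤ ∫⁻ ω, ENNReal.ofReal C * ENNReal.ofReal (urnPotential α γ (fun i => σ * p i)
          (fun i => σ * q i) (fun i => σ * r i) n (drawCounts draw n ω)) ∂μ := by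
          refine lintegral_mono fun ω => ?_
          rw [ENNReal.ofReal_rpow_of_nonneg (urnPotential_pos hk hα hγ h _ _).le hσ0.le,
            ← ENNReal.ofReal_mul hC.le]
          exact ENNReal.ofReal_le_ofReal (hb _ _)
      _ = ENNReal.ofReal C := by
          rw [lintegral_const_mul _ (hX.measurable_urnPotential hα n).ennreal_ofReal,
            hX.lintegral_urnPotential hk hα hγ h', mul_one]

end IsThreeTypeUrn

/-! ### Limits of the draw counts and their joint moments -/

/-- The asymptotics of the draw counts `s n` of a colour. -/
structure HasCountLimits (α : ℝ) (s : ℕ → ℕ × ℕ × ℕ) (x y z : ℝ) : Prop where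
  fst_pos : 0 < x
  snd_pos : 0 < y
  trd_pos : 0 < z
  fst : Tendsto (fun n => ((s n).1 : ℝ) / n) atTop (𝓝 x)
  snd : Tendsto (fun n => ((s n).2.1 : ℝ) / ((s n).1 : ℝ) ^ (1 / α)) atTop (𝓝 y)
  trd : Tendsto (fun n => ((s n).2.2 : ℝ) / ((s n).2.1 : ℝ) ^ (α - 1)) atTop (𝓝 z)
  fst_atTop : Tendsto (fun n => (s n).1) atTop atTop
  snd_atTop : Tendsto (fun n => (s n).2.1) atTop atTop
  trd_atTop : Tendsto (fun n => (s n).2.2) atTop atTop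

/-- The moments of the Dirichlet distribution. -/
noncomputable def dirichletMoment {k : ℕ} (a p : Fin k → ℝ) : ℝ :=
  Real.Gamma (∑ i, a i) / Real.Gamma (∑ i, a i + ∑ i, p i) *
    ∏ i, Real.Gamma (a i + p i) / Real.Gamma (a i)

/-- The moments of the generalized Mittag-Leffler distribution. -/
noncomputable def mittagLefflerMoment (β θ q : ℝ) : ℝ :=
  Real.Gamma (θ / β + q) * Real.Gamma θ / (Real.Gamma (θ / β) * Real.Gamma (θ + β * q))

section

variable {α : ℝ}

lemma AdmissibleExponents.mittagLefflerMoment_snd_pos {g p q r : ℝ} (hα : 1 < α) (hg : 0 < g)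
    (h : AdmissibleExponents α g p q r) : 0 < mittagLefflerMoment (1 / α) (g / α) q := by
  have hga : 0 < g / α := by positivity
  have a1 : g / α / (1 / α) = g := by field_simp
  have a2 : g / α + 1 / α * q = g / α + q / α := by ring
  rw [mittagLefflerMoment, a1, a2]
  exact div_pos (mul_pos (Real.Gamma_pos_of_pos h.snd) (Real.Gamma_pos_of_pos hga))
    (mul_pos (Real.Gamma_pos_of_pos hg) (Real.Gamma_pos_of_pos (h.snd' hα)))

lemma AdmissibleExponents.mittagLefflerMoment_trd_pos {g p q r : ℝ} (hα : 1 < α) (hg : 0 < g)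
    (h : AdmissibleExponents α g p q r) : 0 < mittagLefflerMoment (α - 1) g r := by
  have h1 : 0 < α - 1 := by linarith
  rw [mittagLefflerMoment, mul_comm (α - 1)]
  exact div_pos (mul_pos (Real.Gamma_pos_of_pos h.trd) (Real.Gamma_pos_of_pos hg))
    (mul_pos (Real.Gamma_pos_of_pos (div_pos hg h1)) (Real.Gamma_pos_of_pos (h.trd' hα)))

lemma dirichletMoment_pos {k : ℕ} (hk : 0 < k) {a p : Fin k → ℝ} (ha : ∀ i, 0 < a i)
    (hp : ∀ i, 0 < a i + p i) : 0 < dirichletMoment a p := by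
  have : Nonempty (Fin k) := ⟨⟨0, hk⟩⟩
  refine mul_pos (div_pos (Real.Gamma_pos_of_pos (Finset.sum_pos (fun i _ => ha i)
    Finset.univ_nonempty)) (Real.Gamma_pos_of_pos ?_))
    (Finset.prod_pos fun i _ => div_pos (Real.Gamma_pos_of_pos (hp i))
      (Real.Gamma_pos_of_pos (ha i)))
  rw [← Finset.sum_add_distrib]
  exact Finset.sum_pos (fun i _ => hp i) Finset.univ_nonempty

lemma colourPotential_zero {g : ℝ} (hα : 1 < α) (hg : 0 < g) (s : ℕ × ℕ × ℕ) :
    colourPotential α g 0 0 0 s = 1 := by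
  have h1 : 0 < α - 1 := by linarith
  have hga : 0 < g / α := by positivity
  simp [colourPotential, risingRatio_zero_right, hg, hga, div_pos hg h1]

/-- Exponents carried by a single colour isolate it, since the other colours contribute 1. -/
lemma urnPotential_single {k : ℕ} {γ : Fin k → ℝ} (hα : 1 < α) (hγ : ∀ i, 0 < γ i) (i : Fin k)
    (p q r : ℝ) (n : ℕ) (s : Fin k → ℕ × ℕ × ℕ) :
    urnPotential α γ (Pi.single i p) (Pi.single i q) (Pi.single i r) n s =
      colourPotential α (γ i) p q r (s i) / risingRatio (∑ i, γ i / α) p n := by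
  rw [urnPotential, Finset.prod_eq_single i]
  · simp
  · intro j _ hj
    simp [hj, colourPotential_zero hα (hγ j)]
  · simp

/-- The powers regroup as N^(p - q/α) K^(q - r(α-1)) J^r = N^p (K / N^(1/α))^q (J / K^(α-1))^r. The
constants of the five ratios assemble into the moments of the target laws. -/
lemma tendsto_colourPotential {g p q r x y z : ℝ} {s : ℕ → ℕ × ℕ × ℕ} (hα : 1 < α) (hg : 0 < g)
    (h : AdmissibleExponents α g p q r) (hs : HasCountLimits α s x y z) :
    Tendsto (fun n => colourPotential α g p q r (s n) / (n : ℝ) ^ p) atTop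
      (𝓝 (x ^ p * y ^ q * z ^ r / (Real.Gamma (g / α + p) / Real.Gamma (g / α) *
        mittagLefflerMoment (1 / α) (g / α) q * mittagLefflerMoment (α - 1) g r))) := by
  have h1 : 0 < α - 1 := by linarith
  have hga : 0 < g / α := by positivity
  have hgb : 0 < g / (α - 1) := by positivity
  have hN : Tendsto (fun n => ((s n).1 : ℝ)) atTop atTop :=
    tendsto_natCast_atTop_atTop.comp hs.fst_atTop
  have hK : Tendsto (fun n => ((s n).2.1 : ℝ)) atTop atTop :=
    tendsto_natCast_atTop_atTop.comp hs.snd_atTop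
  have t1 := tendsto_risingRatio_comp hga h.fst hs.fst_atTop
    (tendsto_natCast_atTop_atTop.eventually_gt_atTop 0) hs.fst_pos hs.fst
  have t2 := (tendsto_risingRatio hga (h.snd' hα)).comp hs.fst_atTop
  have t3 := tendsto_risingRatio_comp hg h.snd hs.snd_atTop
    ((hN.eventually_gt_atTop 0).mono fun n hn => Real.rpow_pos_of_pos hn _) hs.snd_pos hs.snd
  have t4 := (tendsto_risingRatio hg (h.trd' hα)).comp hs.snd_atTop
  have t5 := tendsto_risingRatio_comp hgb h.trd hs.trd_atTop
    ((hK.eventually_gt_atTop 0).mono fun n hn => Real.rpow_pos_of_pos hn _) hs.trd_pos hs.trd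
  have G1 := Real.Gamma_pos_of_pos hga
  have G2 := Real.Gamma_pos_of_pos h.fst
  have G3 := Real.Gamma_pos_of_pos (h.snd' hα)
  have G4 := Real.Gamma_pos_of_pos hg
  have G5 := Real.Gamma_pos_of_pos h.snd
  have G6 := Real.Gamma_pos_of_pos (h.trd' hα)
  have G7 := Real.Gamma_pos_of_pos hgb
  have G8 := Real.Gamma_pos_of_pos h.trd
  have t := ((t1.div t2 (div_pos G1 G3).ne').mul (t3.div t4 (div_pos G4 G6).ne')).mul t5
  have e : x ^ p * y ^ q * z ^ r / (Real.Gamma (g / α + p) / Real.Gamma (g / α) *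
        mittagLefflerMoment (1 / α) (g / α) q * mittagLefflerMoment (α - 1) g r) =
      (Real.Gamma (g / α) / Real.Gamma (g / α + p) * x ^ p) /
        (Real.Gamma (g / α) / Real.Gamma (g / α + q / α)) *
      ((Real.Gamma g / Real.Gamma (g + q) * y ^ q) /
        (Real.Gamma g / Real.Gamma (g + r * (α - 1)))) *
      (Real.Gamma (g / (α - 1)) / Real.Gamma (g / (α - 1) + r) * z ^ r) := by
    have a1 : g / α / (1 / α) = g := by field_simp
    have a2 : g / α + 1 / α * q = g / α + q / α := by ring
    rw [mittagLefflerMoment, mittagLefflerMoment, a1, a2, mul_comm (α - 1) r]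
    field_simp
  rw [e]
  refine t.congr' ?_
  filter_upwards [hN.eventually_gt_atTop 0, hK.eventually_gt_atTop 0, eventually_gt_atTop 0]
    with n n1 n2 n3
  have n3' : (0 : ℝ) < n := by exact_mod_cast n3
  have r2 := risingRatio_pos hga (h.snd' hα) (s n).1
  have r4 := risingRatio_pos hg (h.trd' hα) (s n).2.1
  simp only [Function.comp, colourPotential, Pi.div_apply]
  rw [← Real.rpow_mul n1.le, ← Real.rpow_mul n2.le, mul_comm (α - 1) r,
    show 1 / α * q = q / α by ring]
  have p1 := Real.rpow_pos_of_pos n1 (q / α)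
  have p2 := Real.rpow_pos_of_pos n2 (r * (α - 1))
  have p3 := Real.rpow_pos_of_pos n3' p
  field_simp

end

lemma tendsto_urnPotential {k : ℕ} {α : ℝ} {γ p q r x y z : Fin k → ℝ}
    {s : ℕ → Fin k → ℕ × ℕ × ℕ} (hk : 0 < k) (hα : 1 < α) (hγ : ∀ i, 0 < γ i)
    (h : ∀ i, AdmissibleExponents α (γ i) (p i) (q i) (r i))
    (hs : ∀ i, HasCountLimits α (fun n => s n i) (x i) (y i) (z i)) :
    Tendsto (fun n => urnPotential α γ p q r n (s n)) atTop
      (𝓝 ((∏ i, x i ^ p i * y i ^ q i * z i ^ r i) / (dirichletMoment (fun i => γ i / α) p *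
        (∏ i, mittagLefflerMoment (1 / α) (γ i / α) (q i)) *
        ∏ i, mittagLefflerMoment (α - 1) (γ i) (r i)))) := by
  have hA := sum_div_pos hk hα hγ
  have hP := sum_add_pos_of_admissible hk h
  have G1 := Real.Gamma_pos_of_pos hA
  have G2 := Real.Gamma_pos_of_pos hP
  have t := (tendsto_finsetProd (Finset.univ : Finset (Fin k)) fun i _ =>
    tendsto_colourPotential hα (hγ i) (h i) (hs i)).div (tendsto_risingRatio hA hP)
    (div_pos G1 G2).ne'
  have e : (∏ i, x i ^ p i * y i ^ q i * z i ^ r i) / (dirichletMoment (fun i => γ i / α) p *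
        (∏ i, mittagLefflerMoment (1 / α) (γ i / α) (q i)) *
        ∏ i, mittagLefflerMoment (α - 1) (γ i) (r i)) =
      (∏ i, x i ^ p i * y i ^ q i * z i ^ r i / (Real.Gamma (γ i / α + p i) / Real.Gamma (γ i / α) *
        mittagLefflerMoment (1 / α) (γ i / α) (q i) * mittagLefflerMoment (α - 1) (γ i) (r i))) /
        (Real.Gamma (∑ i, γ i / α) / Real.Gamma (∑ i, γ i / α + ∑ i, p i)) := by
    simp only [dirichletMoment, Finset.prod_div_distrib, Finset.prod_mul_distrib, div_div]
    congr 1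
    ring
  rw [e]
  refine t.congr' ?_
  filter_upwards [eventually_gt_atTop 0] with n hn
  have hn' : (0 : ℝ) < n := by exact_mod_cast hn
  simp only [Pi.div_apply, urnPotential]
  rw [Finset.prod_div_distrib, Real.rpow_sum_of_pos hn']
  have : ∏ i, (n : ℝ) ^ p i ≠ 0 := (Finset.prod_pos fun i _ => Real.rpow_pos_of_pos hn' _).ne'
  have := (risingRatio_pos hA hP n).ne'
  field_simp

namespace IsThreeTypeUrn

variable {Ω : Type*} [m : MeasurableSpace Ω] {k : ℕ} {α : ℝ} {γ : Fin k → ℝ}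
    {μ : Measure Ω} [IsProbabilityMeasure μ] {ℱ : Filtration ℕ m}
    {draw : ℕ → Ω → Fin k × UrnType}
    {X : ℕ → Ω → Fin k → UrnType → ℝ} {p q r : Fin k → ℝ}

lemma ae_exists_tendsto_colourPotential (hX : IsThreeTypeUrn α γ μ ℱ draw X) (hk : 0 < k)
    (hα : 1 < α) (hγ : ∀ i, 0 < γ i) (i : Fin k) {p q r : ℝ}
    (h : AdmissibleExponents α (γ i) p q r) :
    ∀ᵐ ω ∂μ, ∃ l, Tendsto (fun n => colourPotential α (γ i) p q r (drawCounts draw n ω i) /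
      risingRatio (∑ i, γ i / α) p n) atTop (𝓝 l) := by
  simp only [← urnPotential_single hα hγ i p q r _ (drawCounts draw _ _)]
  refine hX.ae_exists_tendsto_urnPotential hk hα hγ fun j => ?_
  by_cases hj : j = i
  · subst hj; simpa using h
  · simp only [Pi.single_eq_of_ne hj]
    have h1 : 0 < α - 1 := by linarith
    have := hγ j
    exact ⟨by positivity, by positivity, by positivity⟩

lemma ae_exists_hasCountLimits (hX : IsThreeTypeUrn α γ μ ℱ draw X) (hk : 0 < k)
    (hα : 1 < α) (hγ : ∀ i, 0 < γ i) :
    ∀ᵐ ω ∂μ, ∀ i, ∃ x y z, HasCountLimits α (fun n => drawCounts draw n ω i) x y z := by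
  rw [ae_all_iff]
  intro i
  have h1 : 0 < α - 1 := by linarith
  have hg := hγ i
  have hga : 0 < γ i / α := by positivity
  have hgb : 0 < γ i / (α - 1) := by positivity
  have hA := sum_div_pos hk hα hγ
  have hle : γ i / α ≤ ∑ i, γ i / α := Finset.single_le_sum (f := fun i => γ i / α)
    (fun j _ => div_nonneg (hγ j).le (by linarith)) (Finset.mem_univ i)
  have adm : ∀ p q r, -(γ i / α) < p → -γ i < q → -(γ i / (α - 1)) < r →
      AdmissibleExponents α (γ i) p q r := fun p q r hp hq hr =>
    ⟨by linarith, by linarith, by linarith⟩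
  -- Six martingales: for each of p, q, r in turn, the exponent 1 and half the lower limit of its
  -- admissible range, the other two exponents being 0.
  filter_upwards [
    hX.ae_exists_tendsto_colourPotential hk hα hγ i (adm 1 0 0 (by linarith) (by linarith)
      (by linarith)),
    hX.ae_exists_tendsto_colourPotential hk hα hγ i (adm (-(γ i / α / 2)) 0 0 (by linarith)
      (by linarith) (by linarith)),
    hX.ae_exists_tendsto_colourPotential hk hα hγ i (adm 0 1 0 (by linarith) (by linarith)
      (by linarith)),
    hX.ae_exists_tendsto_colourPotential hk hα hγ i (adm 0 (-(γ i / 2)) 0 (by linarith)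
      (by linarith) (by linarith)),
    hX.ae_exists_tendsto_colourPotential hk hα hγ i (adm 0 0 1 (by linarith) (by linarith)
      (by linarith)),
    hX.ae_exists_tendsto_colourPotential hk hα hγ i (adm 0 0 (-(γ i / (α - 1) / 2)) (by linarith)
      (by linarith) (by linarith))] with ω a1 a2 b1 b2 c1 c2
  simp only [colourPotential, zero_div, zero_mul, risingRatio_zero_right, hga, hgb, hg, hA, div_one,
    mul_one, one_mul, one_div_mul_eq_div] at a1 a2 b1 b2 c1 c2
  -- The three comparisons are chained: n → ∞ gives N → ∞, which gives K → ∞, which gives J → ∞.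
  obtain ⟨x, hx, tx, hN⟩ := exists_tendsto_div_rpow_of_risingRatio hga hA one_pos
    (half_pos hga) (by linarith) (by linarith) tendsto_id a1 (by simpa using a2)
  have hb2 : ∀ n, risingRatio (γ i) (-(γ i / 2)) (drawCounts draw n ω i).2.1 /
      risingRatio (γ i / α) (-(γ i / 2 * (1 / α))) (drawCounts draw n ω i).1 =
      risingRatio (γ i) (-(γ i / 2)) (drawCounts draw n ω i).2.1 /
        risingRatio (γ i / α) (-(γ i / 2) / α) (drawCounts draw n ω i).1 := by
    intro n
    rw [show -(γ i / 2 * (1 / α)) = -(γ i / 2) / α by ring]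
  obtain ⟨y, hy, ty, hK⟩ := exists_tendsto_div_rpow_of_risingRatio hg hga
    (e := 1 / α) (by positivity) (half_pos hg) (by linarith)
    (by rw [mul_one_div]; gcongr; linarith) hN b1
    (by simp only [hb2]; simpa using b2)
  obtain ⟨z, hz, tz, hJ⟩ := exists_tendsto_div_rpow_of_risingRatio hgb hg h1 (half_pos hgb)
    (by linarith) (by rw [div_right_comm, div_mul_cancel₀ _ h1.ne']; linarith) hK c1
    (by simpa only [neg_mul] using c2)
  exact ⟨x, y, z, hx, hy, hz, by simpa using tx, ty, tz, hN, hK, hJ⟩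

/-- The draw counts of the urn have almost sure limits. -/
lemma exists_measurable_limits (hX : IsThreeTypeUrn α γ μ ℱ draw X) (hk : 0 < k)
    (hα : 1 < α) (hγ : ∀ i, 0 < γ i) :
    ∃ D R Rbar : Ω → Fin k → ℝ, Measurable D ∧ Measurable R ∧ Measurable Rbar ∧
      ∀ᵐ ω ∂μ, ∀ i, HasCountLimits α (fun n => drawCounts draw n ω i) (D ω i) (R ω i)
        (Rbar ω i) := by
  have h := hX.ae_exists_hasCountLimits hk hα hγ
  have hm : ∀ (n : ℕ) (G : ℕ → ℕ × ℕ × ℕ → ℝ),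
      AEMeasurable (fun ω i => G n (drawCounts draw n ω i)) μ := fun n G =>
    (measurable_pi_lambda _ fun i => ((hX.stronglyMeasurable_comp_drawCounts hα n
      fun s => G n (s i)).mono (ℱ.le n)).measurable).aemeasurable
  obtain ⟨D, hD, tD⟩ := measurable_limit_of_tendsto_metrizable_ae (μ := μ) (L := atTop)
    (f := fun (n : ℕ) ω i => ((drawCounts draw n ω i).1 : ℝ) / n)
    (fun n => hm n fun n s => (s.1 : ℝ) / n) (by
      filter_upwards [h] with ω hω
      choose x y z hs using hω
      exact ⟨x, tendsto_pi_nhds.2 fun i => (hs i).fst⟩)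
  obtain ⟨R, hR, tR⟩ := measurable_limit_of_tendsto_metrizable_ae (μ := μ) (L := atTop)
    (f := fun (n : ℕ) ω i => ((drawCounts draw n ω i).2.1 : ℝ) /
      ((drawCounts draw n ω i).1 : ℝ) ^ (1 / α))
    (fun n => hm n fun n s => (s.2.1 : ℝ) / (s.1 : ℝ) ^ (1 / α)) (by
      filter_upwards [h] with ω hω
      choose x y z hs using hω
      exact ⟨y, tendsto_pi_nhds.2 fun i => (hs i).snd⟩)
  obtain ⟨Rbar, hRbar, tRbar⟩ := measurable_limit_of_tendsto_metrizable_ae (μ := μ) (L := atTop)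
    (f := fun (n : ℕ) ω i => ((drawCounts draw n ω i).2.2 : ℝ) /
      ((drawCounts draw n ω i).2.1 : ℝ) ^ (α - 1))
    (fun n => hm n fun n s => (s.2.2 : ℝ) / (s.2.1 : ℝ) ^ (α - 1)) (by
      filter_upwards [h] with ω hω
      choose x y z hs using hω
      exact ⟨z, tendsto_pi_nhds.2 fun i => (hs i).trd⟩)
  refine ⟨D, R, Rbar, hD, hR, hRbar, ?_⟩
  filter_upwards [h, tD, tR, tRbar] with ω hω t1 t2 t3 i
  obtain ⟨x, y, z, hs⟩ := hω i
  rw [tendsto_nhds_unique (tendsto_pi_nhds.1 t1 i) hs.fst,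
    tendsto_nhds_unique (tendsto_pi_nhds.1 t2 i) hs.snd,
    tendsto_nhds_unique (tendsto_pi_nhds.1 t3 i) hs.trd]
  exact hs

/-- The joint moments of the limits of the draw counts. -/
lemma lintegral_prod_limits (hX : IsThreeTypeUrn α γ μ ℱ draw X) (hk : 0 < k)
    (hα : 1 < α) (hγ : ∀ i, 0 < γ i) {D R Rbar : Ω → Fin k → ℝ}
    (hlim : ∀ᵐ ω ∂μ, ∀ i, HasCountLimits α (fun n => drawCounts draw n ω i) (D ω i) (R ω i)
      (Rbar ω i)) (h : ∀ i, AdmissibleExponents α (γ i) (p i) (q i) (r i)) :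
    ∫⁻ ω, ENNReal.ofReal (∏ i, D ω i ^ p i * R ω i ^ q i * Rbar ω i ^ r i) ∂μ =
      ENNReal.ofReal (dirichletMoment (fun i => γ i / α) p *
        (∏ i, mittagLefflerMoment (1 / α) (γ i / α) (q i)) *
        ∏ i, mittagLefflerMoment (α - 1) (γ i) (r i)) := by
  set c := dirichletMoment (fun i => γ i / α) p *
        (∏ i, mittagLefflerMoment (1 / α) (γ i / α) (q i)) *
        ∏ i, mittagLefflerMoment (α - 1) (γ i) (r i)
  have hc0 : 0 < c := mul_pos (mul_pos
    (dirichletMoment_pos hk (fun i => div_pos (hγ i) (by linarith)) fun i => (h i).fst)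
    (Finset.prod_pos fun i _ => (h i).mittagLefflerMoment_snd_pos hα (hγ i)))
    (Finset.prod_pos fun i _ => (h i).mittagLefflerMoment_trd_pos hα (hγ i))
  -- The martingale limit is the product of powers divided by `c`, and it has mean 1, so `c` is the
  -- moment.
  have key := hX.lintegral_of_tendsto_urnPotential hk hα hγ h
    (G := fun ω => (∏ i, D ω i ^ p i * R ω i ^ q i * Rbar ω i ^ r i) / c) (by
      filter_upwards [hlim] with ω hω using tendsto_urnPotential hk hα hγ h hω)
  have hcE : ENNReal.ofReal c ≠ 0 := by simpa using hc0
  simp only [ENNReal.ofReal_div_of_pos hc0] at key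
  simp only [div_eq_mul_inv] at key
  rw [lintegral_mul_const' _ _ (ENNReal.inv_ne_top.2 hcE), ← div_eq_mul_inv,
    ENNReal.div_eq_one_iff hcE ENNReal.ofReal_ne_top] at key
  exact key

end IsThreeTypeUrn

/-! ### Laws determined by moments of real order -/

/-- Moment generating functions that agree on an open interval have equal complex extensions on the
corresponding strip. -/
lemma complexMGF_eq_of_mgf_eqOn_Ioo {Ω Ω' : Type*} [MeasurableSpace Ω] [MeasurableSpace Ω']
    {μ : Measure Ω} {μ' : Measure Ω'} {X : Ω → ℝ} {Y : Ω' → ℝ} {l u : ℝ}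
    (hX : ∀ t ∈ Set.Ioo l u, Integrable (fun ω => Real.exp (t * X ω)) μ)
    (hY : ∀ t ∈ Set.Ioo l u, Integrable (fun ω => Real.exp (t * Y ω)) μ')
    (h : ∀ t ∈ Set.Ioo l u, mgf X μ t = mgf Y μ' t) {z : ℂ} (hz : z.re ∈ Set.Ioo l u) :
    complexMGF X μ z = complexMGF Y μ' z := by
  have hXs : Set.Ioo l u ⊆ interior (integrableExpSet X μ) := interior_maximal hX isOpen_Ioo
  have hYs : Set.Ioo l u ⊆ interior (integrableExpSet Y μ') := interior_maximal hY isOpen_Ioo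
  have aX : AnalyticOnNhd ℂ (complexMGF X μ) {z | z.re ∈ Set.Ioo l u} :=
    analyticOnNhd_complexMGF.mono fun z hz => hXs hz
  have aY : AnalyticOnNhd ℂ (complexMGF Y μ') {z | z.re ∈ Set.Ioo l u} :=
    analyticOnNhd_complexMGF.mono fun z hz => hYs hz
  refine AnalyticOnNhd.eqOn_of_preconnected_of_frequently_eq aX aY
    ((convex_Ioo l u).linear_preimage Complex.reLm).isPreconnected
    (z₀ := (z.re : ℂ)) (by simpa using hz) ?_ hz
  -- The real points of the strip accumulate at `z.re`, which suffices for the identity theorem.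
  have h_real : ∃ᶠ (x : ℝ) in 𝓝[≠] z.re, complexMGF X μ x = complexMGF Y μ' x := by
    refine Eventually.frequently ?_
    filter_upwards [nhdsWithin_le_nhds (isOpen_Ioo.mem_nhds hz)] with x hx
    rw [complexMGF_ofReal, complexMGF_ofReal, h x hx]
  rw [frequently_iff_seq_forall] at h_real ⊢
  obtain ⟨xs, hx_tendsto, hx_eq⟩ := h_real
  refine ⟨fun n => xs n, ?_, fun n => by simp [hx_eq]⟩
  rw [tendsto_nhdsWithin_iff] at hx_tendsto ⊢
  exact ⟨(Complex.continuous_ofReal.tendsto _).comp hx_tendsto.1, by simpa using hx_tendsto.2⟩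

/-- The law of a positive random vector is determined by its moments of small real order. -/
lemma map_eq_map_of_lintegral_prod_rpow_eq {E E' ι : Type*} [Fintype ι] [MeasurableSpace E]
    [MeasurableSpace E'] {P : Measure E} {Q : Measure E'} [IsFiniteMeasure P] [IsFiniteMeasure Q]
    {Y : E → ι → ℝ} {Z : E' → ι → ℝ} (hY : Measurable Y) (hZ : Measurable Z)
    (hP : ∀ᵐ x ∂P, ∀ i, 0 < Y x i) (hQ : ∀ᵐ x ∂Q, ∀ i, 0 < Z x i) {ε : ℝ} (hε : 0 < ε)
    (hfin : ∀ t : ι → ℝ, (∀ i, |t i| < ε) → ∫⁻ x, ENNReal.ofReal (∏ i, Y x i ^ t i) ∂P ≠ ∞)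
    (heq : ∀ t : ι → ℝ, (∀ i, |t i| < ε) → ∫⁻ x, ENNReal.ofReal (∏ i, Y x i ^ t i) ∂P =
      ∫⁻ x, ENNReal.ofReal (∏ i, Z x i ^ t i) ∂Q) :
    P.map Y = Q.map Z := by
  classical
  have hLY : Measurable fun x i => Real.log (Y x i) := by fun_prop
  have hLZ : Measurable fun x i => Real.log (Z x i) := by fun_prop
  -- The moments of the vector are the exponential moments of linear functionals of its logarithm,
  -- which is where characteristic functions apply.
  have hlog : P.map (fun x i => Real.log (Y x i)) = Q.map (fun x i => Real.log (Z x i)) := by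
    refine Measure.ext_of_charFunDual ?_
    ext L
    set t : ι → ℝ := fun i => L (Pi.single i 1) with ht
    have hL : ∀ v : ι → ℝ, L v = ∑ i, v i * t i := by
      intro v
      conv_lhs => rw [pi_eq_sum_univ' v, map_sum]
      simp only [map_smul, smul_eq_mul, ht]
    have hexp : ∀ (s : ℝ) (y : ι → ℝ), (∀ i, 0 < y i) →
        ∏ i, y i ^ (s * t i) = Real.exp (s * L fun i => Real.log (y i)) := by
      intro s y hy
      rw [hL, Finset.mul_sum, Real.exp_sum]
      refine Finset.prod_congr rfl fun i _ => ?_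
      rw [Real.rpow_def_of_pos (hy i)]
      ring_nf
    -- For |s| below this bound every order `s * t i` is less than ε in absolute value; the summand
    -- 1 covers t = 0.
    have hδ : 0 < ε / (1 + ∑ i, |t i|) := by
      have : 0 ≤ ∑ i, |t i| := Finset.sum_nonneg fun i _ => abs_nonneg _
      positivity
    have hst : ∀ s ∈ Set.Ioo (-(ε / (1 + ∑ i, |t i|))) (ε / (1 + ∑ i, |t i|)), ∀ i,
        |s * t i| < ε := by
      intro s hs i
      have h0 : 0 ≤ ∑ i, |t i| := Finset.sum_nonneg fun i _ => abs_nonneg _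
      have h1 : |t i| ≤ ∑ i, |t i| :=
        Finset.single_le_sum (f := fun i => |t i|) (fun i _ => abs_nonneg _) (Finset.mem_univ i)
      have h2 := abs_lt.2 hs
      rw [lt_div_iff₀ (by positivity)] at h2
      rw [abs_mul]
      refine lt_of_le_of_lt ?_ h2
      gcongr
      linarith
    have eY : ∀ s : ℝ, ∫⁻ x, ENNReal.ofReal (∏ i, Y x i ^ (s * t i)) ∂P =
        ∫⁻ x, ENNReal.ofReal (Real.exp (s * L fun i => Real.log (Y x i))) ∂P := fun s =>
      lintegral_congr_ae (by filter_upwards [hP] with x hx; rw [hexp s _ hx])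
    have eZ : ∀ s : ℝ, ∫⁻ x, ENNReal.ofReal (∏ i, Z x i ^ (s * t i)) ∂Q =
        ∫⁻ x, ENNReal.ofReal (Real.exp (s * L fun i => Real.log (Z x i))) ∂Q := fun s =>
      lintegral_congr_ae (by filter_upwards [hQ] with x hx; rw [hexp s _ hx])
    have mY : Measurable fun x => L fun i => Real.log (Y x i) := L.continuous.measurable.comp hLY
    have mZ : Measurable fun x => L fun i => Real.log (Z x i) := L.continuous.measurable.comp hLZ
    have nY : ∀ s : ℝ, AEStronglyMeasurable
        (fun x => Real.exp (s * L fun i => Real.log (Y x i))) P := fun s =>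
      (Real.measurable_exp.comp (mY.const_mul s)).aestronglyMeasurable
    have nZ : ∀ s : ℝ, AEStronglyMeasurable
        (fun x => Real.exp (s * L fun i => Real.log (Z x i))) Q := fun s =>
      (Real.measurable_exp.comp (mZ.const_mul s)).aestronglyMeasurable
    -- The point i lies on the line Re z = 0 inside the strip, and the extension there is the
    -- characteristic function.
    have key := complexMGF_eq_of_mgf_eqOn_Ioo (μ := P) (μ' := Q)
      (X := fun x => L fun i => Real.log (Y x i)) (Y := fun x => L fun i => Real.log (Z x i))
      (fun s hs => ?_) (fun s hs => ?_) (fun s hs => ?_) (z := Complex.I)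
      (l := -(ε / (1 + ∑ i, |t i|))) (u := ε / (1 + ∑ i, |t i|)) (by simpa using hδ)
    · rw [charFunDual_apply, charFunDual_apply, integral_map hLY.aemeasurable (by fun_prop),
        integral_map hLZ.aemeasurable (by fun_prop)]
      simpa only [complexMGF, mul_comm Complex.I] using key
    · rw [← lintegral_ofReal_ne_top_iff_integrable (nY s)
        (Eventually.of_forall fun x => (Real.exp_pos _).le), ← eY]
      exact hfin _ (hst s hs)
    · rw [← lintegral_ofReal_ne_top_iff_integrable (nZ s)
        (Eventually.of_forall fun x => (Real.exp_pos _).le), ← eZ, ← heq _ (hst s hs)]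
      exact hfin _ (hst s hs)
    · rw [mgf, mgf, integral_eq_lintegral_of_nonneg_ae
        (Eventually.of_forall fun x => (Real.exp_pos _).le) (nY s),
        integral_eq_lintegral_of_nonneg_ae
        (Eventually.of_forall fun x => (Real.exp_pos _).le) (nZ s), ← eY, ← eZ,
        heq _ (hst s hs)]
  have hE : Measurable fun (v : ι → ℝ) i => Real.exp (v i) := by fun_prop
  have h1 : P.map Y = (P.map fun x i => Real.log (Y x i)).map fun v i => Real.exp (v i) := by
    rw [Measure.map_map hE hLY]
    refine Measure.map_congr ?_
    filter_upwards [hP] with x hx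
    ext i
    simp [Real.exp_log (hx i)]
  have h2 : Q.map Z = (Q.map fun x i => Real.log (Z x i)).map fun v i => Real.exp (v i) := by
    rw [Measure.map_map hE hLZ]
    refine Measure.map_congr ?_
    filter_upwards [hQ] with x hx
    ext i
    simp [Real.exp_log (hx i)]
  rw [h1, h2, hlog]

/-- A measure on the positive half-line is determined by its moments of orders in an interval. -/
lemma eq_of_lintegral_rpow_eq {P Q : Measure ℝ} (hP : ∀ᵐ x ∂P, 0 < x) (hQ : ∀ᵐ x ∂Q, 0 < x)
    {l u : ℝ} (hlu : l < u)
    (hfin : ∀ t ∈ Set.Ioo l u, ∫⁻ x, ENNReal.ofReal (x ^ t) ∂P ≠ ∞)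
    (heq : ∀ t ∈ Set.Ioo l u, ∫⁻ x, ENNReal.ofReal (x ^ t) ∂P =
      ∫⁻ x, ENNReal.ofReal (x ^ t) ∂Q) : P = Q := by
  set c := (l + u) / 2
  set f : ℝ → ℝ≥0∞ := fun x => ENNReal.ofReal (x ^ c) with hf
  have hfm : Measurable f := by fun_prop
  have hc : c ∈ Set.Ioo l u := ⟨by simp only [c]; linarith, by simp only [c]; linarith⟩
  -- P itself may be infinite and the interval of orders need not contain 0. Tilting by x^c, with c
  -- the midpoint, makes the measure finite and centres the interval at 0; the tilt is undone at the
  -- end.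
  have : IsFiniteMeasure (P.withDensity f) := isFiniteMeasure_withDensity (hfin c hc)
  have : IsFiniteMeasure (Q.withDensity f) := isFiniteMeasure_withDensity (heq c hc ▸ hfin c hc)
  have hmul : ∀ (M : Measure ℝ), (∀ᵐ x ∂M, 0 < x) → ∀ t : ℝ,
      ∫⁻ x, ENNReal.ofReal (x ^ t) ∂(M.withDensity f) = ∫⁻ x, ENNReal.ofReal (x ^ (c + t)) ∂M := by
    intro M hM t
    rw [lintegral_withDensity_eq_lintegral_mul _ hfm (by fun_prop)]
    refine lintegral_congr_ae ?_
    filter_upwards [hM] with x hx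
    rw [Pi.mul_apply, hf, ← ENNReal.ofReal_mul (by positivity), ← Real.rpow_add hx]
  have ht : ∀ t : ℝ, |t| < (u - l) / 2 → c + t ∈ Set.Ioo l u := by
    intro t ht
    rw [abs_lt] at ht
    constructor <;> simp only [c] <;> linarith
  have hY : Measurable fun (x : ℝ) (_ : Unit) => x := by fun_prop
  have key := map_eq_map_of_lintegral_prod_rpow_eq (P := P.withDensity f) (Q := Q.withDensity f)
    hY hY (withDensity_absolutelyContinuous P f (hP.mono fun x hx _ => hx))
    (withDensity_absolutelyContinuous Q f (hQ.mono fun x hx _ => hx))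
    (ε := (u - l) / 2) (by linarith) (fun t h => by
      simpa [hmul P hP] using hfin _ (ht _ (h ()))) (fun t h => by
      simpa [hmul P hP, hmul Q hQ] using heq _ (ht _ (h ())))
  have key' := congrArg (Measure.map fun v : Unit → ℝ => v ()) key
  rw [Measure.map_map (by fun_prop) hY, Measure.map_map (by fun_prop) hY] at key'
  simp only [Function.comp_def, Measure.map_id'] at key'
  have hne : ∀ M : Measure ℝ, (∀ᵐ x ∂M, 0 < x) → ∀ᵐ x ∂M, f x ≠ 0 := fun M hM => by
    filter_upwards [hM] with x hx
    simpa [hf] using Real.rpow_pos_of_pos hx c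
  rw [← withDensity_inv_same hfm (hne P hP) (Eventually.of_forall fun x => ENNReal.ofReal_ne_top),
    ← withDensity_inv_same hfm (hne Q hQ) (Eventually.of_forall fun x => ENNReal.ofReal_ne_top),
    key']

/-! ### The Dirichlet integral -/

/-- The convolution kernel `x ^ (b - 1) / Γ(b)` on the half-line. -/
noncomputable def gammaKernel (b x : ℝ) : ℝ≥0∞ :=
  if 0 ≤ x then ENNReal.ofReal (x ^ (b - 1) / Real.Gamma b) else 0

@[fun_prop]
lemma measurable_gammaKernel (b : ℝ) : Measurable (gammaKernel b) :=
  Measurable.ite measurableSet_Ici (by fun_prop) measurable_const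

lemma gammaKernel_of_nonneg {b x : ℝ} (hx : 0 ≤ x) :
    gammaKernel b x = ENNReal.ofReal (x ^ (b - 1) / Real.Gamma b) := if_pos hx

lemma gammaKernel_of_neg {b x : ℝ} (hx : x < 0) : gammaKernel b x = 0 := if_neg hx.not_ge

lemma gammaKernel_mul {b T : ℝ} (hT : 0 < T) (x : ℝ) :
    gammaKernel b (T * x) = ENNReal.ofReal (T ^ (b - 1)) * gammaKernel b x := by
  rcases lt_or_ge x 0 with hx | hx
  · rw [gammaKernel_of_neg hx, gammaKernel_of_neg (mul_neg_of_pos_of_neg hT hx), mul_zero]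
  · rw [gammaKernel_of_nonneg hx, gammaKernel_of_nonneg (by positivity),
      ← ENNReal.ofReal_mul (by positivity), Real.mul_rpow hT.le hx, mul_div_assoc]

/-- For T = 1 this is the Beta integral, and scaling gives every T > 0. The point T = 0 is excluded
because the integral vanishes there while, for a + b = 1, the right side equals 1. -/
lemma lintegral_gammaKernel_mul_gammaKernel {a b T : ℝ} (ha : 0 < a) (hb : 0 < b) (hT : T ≠ 0) :
    ∫⁻ x, gammaKernel a x * gammaKernel b (T - x) = gammaKernel (a + b) T := by
  have Ga := Real.Gamma_pos_of_pos ha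
  have Gb := Real.Gamma_pos_of_pos hb
  have Gab := Real.Gamma_pos_of_pos (add_pos ha hb)
  rcases hT.lt_or_gt with hT | hT
  · rw [gammaKernel_of_neg hT, lintegral_eq_zero_iff (by fun_prop)]
    refine Eventually.of_forall fun x => ?_
    rcases lt_or_ge x 0 with hx | hx
    · simp [gammaKernel_of_neg hx]
    · simp [gammaKernel_of_neg (show T - x < 0 by linarith)]
  · have h1 : ∫⁻ x, gammaKernel a x * gammaKernel b (1 - x) =
        ENNReal.ofReal (1 / Real.Gamma (a + b)) := by
      calc ∫⁻ x, gammaKernel a x * gammaKernel b (1 - x)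
          = ∫⁻ x, ENNReal.ofReal (1 / Real.Gamma (a + b)) * betaPDF a b x := by
            refine lintegral_congr_ae ?_
            filter_upwards [Measure.ae_ne volume (0 : ℝ), Measure.ae_ne volume (1 : ℝ)]
              with x h0 h1
            rcases h0.lt_or_gt with h0 | h0
            · rw [gammaKernel_of_neg h0, betaPDF_eq_zero_of_nonpos h0.le]; simp
            rcases h1.lt_or_gt with h1 | h1
            · have h1' : 0 < 1 - x := by linarith
              rw [gammaKernel_of_nonneg h0.le, gammaKernel_of_nonneg h1'.le,
                betaPDF_of_pos_lt_one h0 h1, ← ENNReal.ofReal_mul (by positivity),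
                ← ENNReal.ofReal_mul (by positivity), beta]
              congr 1
              field_simp
            · rw [gammaKernel_of_neg (show 1 - x < 0 by linarith),
                betaPDF_eq_zero_of_one_le h1.le]; simp
        _ = _ := by
            rw [lintegral_const_mul' _ _ ENNReal.ofReal_ne_top, lintegral_betaPDF_eq_one ha hb,
              mul_one]
    have hm : Measurable fun x => gammaKernel a x * gammaKernel b (T - x) := by fun_prop
    rw [← Real.smul_map_volume_mul_left hT.ne', lintegral_smul_measure,
      lintegral_map hm (by fun_prop)]
    have h2 : ∀ x, gammaKernel a (T * x) * gammaKernel b (T - T * x) =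
        ENNReal.ofReal (T ^ (a - 1) * T ^ (b - 1)) *
          (gammaKernel a x * gammaKernel b (1 - x)) := by
      intro x
      rw [show T - T * x = T * (1 - x) by ring, gammaKernel_mul hT, gammaKernel_mul hT,
        ENNReal.ofReal_mul (by positivity)]
      ring
    simp only [h2]
    rw [lintegral_const_mul' _ _ ENNReal.ofReal_ne_top, h1, gammaKernel_of_nonneg hT.le,
      smul_eq_mul, ← ENNReal.ofReal_mul (by positivity), ← ENNReal.ofReal_mul (by positivity)]
    congr 1
    rw [abs_of_pos hT, ← Real.rpow_add hT, ← mul_assoc, mul_one_div]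
    congr 1
    nth_rewrite 1 [← Real.rpow_one T]
    rw [← Real.rpow_add hT]
    congr 1
    ring

/-- The kernels form a convolution semigroup. Integrating out one coordinate at a time only meets T
- x = 0 on a null set. -/
lemma lintegral_prod_gammaKernel {n : ℕ} {b : Fin n → ℝ} {c T : ℝ} (hb : ∀ i, 0 < b i)
    (hc : 0 < c) (hT : T ≠ 0) :
    ∫⁻ x : Fin n → ℝ, (∏ i, gammaKernel (b i) (x i)) * gammaKernel c (T - ∑ i, x i) =
      gammaKernel (∑ i, b i + c) T := by
  induction n generalizing T with
  | zero => simp [lintegral_unique, volume_pi]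
  | succ n ih =>
    have hm : ∀ S : ℝ, Measurable fun x : Fin n → ℝ =>
        (∏ i, gammaKernel (b i.succ) (x i)) * gammaKernel c (S - ∑ i, x i) := fun S => by
      fun_prop
    have hm2 : Measurable fun z : ℝ × (Fin n → ℝ) => gammaKernel (b 0) z.1 *
        ((∏ i, gammaKernel (b i.succ) (z.2 i)) * gammaKernel c (T - z.1 - ∑ i, z.2 i)) := by
      fun_prop
    rw [← (volume_preserving_piFinSuccAbove (fun _ : Fin (n + 1) => ℝ) 0).symm.lintegral_comp
      (by fun_prop)]
    have e : ∀ z : ℝ × (Fin n → ℝ),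
        (∏ i, gammaKernel (b i) ((MeasurableEquiv.piFinSuccAbove (fun _ : Fin (n + 1) => ℝ)
          0).symm z i)) * gammaKernel c (T - ∑ i,
          (MeasurableEquiv.piFinSuccAbove (fun _ : Fin (n + 1) => ℝ) 0).symm z i) =
        gammaKernel (b 0) z.1 *
        ((∏ i, gammaKernel (b i.succ) (z.2 i)) * gammaKernel c (T - z.1 - ∑ i, z.2 i)) := by
      intro z
      simp [MeasurableEquiv.piFinSuccAbove_symm_apply, Fin.prod_univ_succ, Fin.sum_univ_succ,
        Fin.insertNthEquiv, mul_assoc, sub_sub]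
    simp only [e]
    rw [Measure.volume_eq_prod, lintegral_prod _ hm2.aemeasurable]
    simp only
    calc _ = ∫⁻ x, gammaKernel (b 0) x * gammaKernel (∑ i : Fin n, b i.succ + c) (T - x) := by
          refine lintegral_congr_ae ?_
          filter_upwards [Measure.ae_ne volume T] with x hx
          rw [lintegral_const_mul _ (hm _), ih (fun i => hb _) (sub_ne_zero.2 hx.symm)]
      _ = _ := by
          rw [lintegral_gammaKernel_mul_gammaKernel (hb 0)
            (add_pos_of_nonneg_of_pos (Finset.sum_nonneg fun i _ => (hb _).le) hc) hT,
            Fin.sum_univ_succ, add_assoc]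

/-- The boundary of the simplex is null. For the slanted face, the sum is a surjective linear
functional, so it maps Lebesgue measure to a multiple of Haar measure, which has no atoms. -/
lemma ae_pos_of_mem_simplex (n : ℕ) :
    ∀ᵐ x : Fin n → ℝ, ((∀ i, 0 ≤ x i) ∧ ∑ i, x i ≤ 1) → (∀ i, 0 < x i) ∧ 0 < 1 - ∑ i, x i := by
  have h1 : ∀ᵐ x : Fin n → ℝ, ∀ i, x i ≠ 0 := by
    rw [ae_all_iff]
    intro i
    exact (Measure.quasiMeasurePreserving_eval (fun _ => (volume : Measure ℝ)) i).ae
      (Measure.ae_ne volume (0 : ℝ))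
  have h2 : ∀ᵐ x : Fin n → ℝ, ∑ i, x i ≠ 1 := by
    rcases Nat.eq_zero_or_pos n with rfl | hn
    · simp
    let L : (Fin n → ℝ) →ₗ[ℝ] ℝ := ∑ i, LinearMap.proj i
    have hL : ∀ x, L x = ∑ i, x i := fun x => by simp [L]
    have hsurj : Function.Surjective L := fun y => ⟨Pi.single ⟨0, hn⟩ y, by rw [hL]; simp⟩
    obtain ⟨c, -, hc⟩ := L.exists_map_addHaar_eq_smul_addHaar volume volume hsurj
    have hLm : Measurable L := L.continuous_of_finiteDimensional.measurable
    have : ∀ᵐ y ∂(Measure.map L volume), y ≠ 1 := by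
      rw [hc, ae_iff]
      simp
    filter_upwards [ae_of_ae_map hLm.aemeasurable this] with x hx
    rwa [hL] at hx
  filter_upwards [h1, h2] with x hx hx' h
  exact ⟨fun i => (h.1 i).lt_of_ne' (hx i), sub_pos.2 (h.2.lt_of_ne hx')⟩

lemma measurable_simplexPoint (n : ℕ) : Measurable
    fun x : Fin n → ℝ => (Fin.snoc x (1 - ∑ i, x i) : Fin (n + 1) → ℝ) := by
  refine measurable_pi_lambda _ fun i => ?_
  refine Fin.lastCases ?_ (fun j => ?_) i
  · simp only [Fin.snoc_last]; fun_prop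
  · simp only [Fin.snoc_castSucc]; fun_prop

lemma measurableSet_simplex (n : ℕ) :
    MeasurableSet {x : Fin n → ℝ | (∀ i, 0 ≤ x i) ∧ ∑ i, x i ≤ 1} := by
  have : {x : Fin n → ℝ | (∀ i, 0 ≤ x i) ∧ ∑ i, x i ≤ 1} =
      (⋂ i, {x | 0 ≤ x i}) ∩ {x | ∑ i, x i ≤ 1} := by ext; simp
  rw [this]
  exact (MeasurableSet.iInter fun i => measurableSet_le measurable_const
    (measurable_pi_apply i)).inter (measurableSet_le (by fun_prop) measurable_const)

lemma ae_pos_simplexLebesgue (k : ℕ) : ∀ᵐ x ∂(simplexLebesgue k), ∀ i, 0 < x i := by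
  cases k with
  | zero => simp [simplexLebesgue]
  | succ n =>
    have hs : MeasurableSet {x : Fin (n + 1) → ℝ | ∀ i, 0 < x i} := by
      have : {x : Fin (n + 1) → ℝ | ∀ i, 0 < x i} = ⋂ i, {x | 0 < x i} := by ext; simp
      rw [this]
      exact MeasurableSet.iInter fun i => measurableSet_lt measurable_const (measurable_pi_apply i)
    rw [simplexLebesgue, ae_map_iff (measurable_simplexPoint n).aemeasurable hs,
      ae_restrict_iff' (measurableSet_simplex n)]
    filter_upwards [ae_pos_of_mem_simplex n] with x hx h i
    refine Fin.lastCases ?_ (fun j => ?_) i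
    · simpa only [Fin.snoc_last] using (hx h).2
    · simpa only [Fin.snoc_castSucc] using (hx h).1 j

lemma ae_pos_dirichletMeasure {k : ℕ} (a : Fin k → ℝ) :
    ∀ᵐ x ∂(dirichletMeasure a), ∀ i, 0 < x i :=
  withDensity_absolutelyContinuous _ _ (ae_pos_simplexLebesgue k)

/-- The Dirichlet integral. -/
lemma lintegral_simplexLebesgue_prod_rpow {k : ℕ} (hk : 0 < k) {b : Fin k → ℝ}
    (hb : ∀ i, 0 < b i) :
    ∫⁻ x, ENNReal.ofReal (∏ i, x i ^ (b i - 1)) ∂(simplexLebesgue k) =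
      ENNReal.ofReal ((∏ i, Real.Gamma (b i)) / Real.Gamma (∑ i, b i)) := by
  obtain ⟨n, rfl⟩ := Nat.exists_eq_succ_of_ne_zero hk.ne'
  have G : ∀ i, 0 < Real.Gamma (b i) := fun i => Real.Gamma_pos_of_pos (hb i)
  rw [simplexLebesgue, lintegral_map (by fun_prop) (measurable_simplexPoint n),
    ← lintegral_indicator (measurableSet_simplex n)]
  -- The kernels vanish on the negative half-line, so their product encodes the indicator of the
  -- simplex.
  have e : ∀ x : Fin n → ℝ, Set.indicator {x : Fin n → ℝ | (∀ i, 0 ≤ x i) ∧ ∑ i, x i ≤ 1}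
      (fun x => ENNReal.ofReal (∏ i : Fin (n + 1),
        (Fin.snoc x (1 - ∑ i, x i) : Fin (n + 1) → ℝ) i ^ (b i - 1))) x =
      ENNReal.ofReal (∏ i, Real.Gamma (b i)) *
      ((∏ i, gammaKernel (b (Fin.castSucc i)) (x i)) *
        gammaKernel (b (Fin.last n)) (1 - ∑ i, x i)) := by
    intro x
    by_cases hx : (∀ i, 0 ≤ x i) ∧ ∑ i, x i ≤ 1
    · rw [Set.indicator_of_mem (by simpa using hx), gammaKernel_of_nonneg (by linarith [hx.2]),
        Finset.prod_congr rfl fun i _ => gammaKernel_of_nonneg (hx.1 i),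
        ← ENNReal.ofReal_prod_of_nonneg fun i _ =>
          div_nonneg (Real.rpow_nonneg (hx.1 i) _) (G _).le,
        ← ENNReal.ofReal_mul (Finset.prod_nonneg fun i _ =>
          div_nonneg (Real.rpow_nonneg (hx.1 i) _) (G _).le),
        ← ENNReal.ofReal_mul (Finset.prod_nonneg fun i _ => (G i).le)]
      congr 1
      rw [Fin.prod_univ_castSucc, Fin.prod_univ_castSucc, Finset.prod_div_distrib]
      simp only [Fin.snoc_castSucc, Fin.snoc_last]
      have := (G (Fin.last n)).ne'
      have : ∏ i : Fin n, Real.Gamma (b i.castSucc) ≠ 0 :=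
        (Finset.prod_pos fun i _ => G _).ne'
      field_simp
    · rw [Set.indicator_of_notMem (by simpa using hx)]
      symm
      rw [mul_eq_zero]
      right
      rw [not_and_or, not_forall] at hx
      rcases hx with ⟨i, hi⟩ | hx
      · rw [Finset.prod_eq_zero (Finset.mem_univ i) (gammaKernel_of_neg (not_le.1 hi)), zero_mul]
      · rw [gammaKernel_of_neg (by linarith [not_le.1 hx]), mul_zero]
  simp only [e]
  rw [lintegral_const_mul' _ _ ENNReal.ofReal_ne_top,
    lintegral_prod_gammaKernel (fun i => hb _) (hb _) one_ne_zero,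
    gammaKernel_of_nonneg zero_le_one,
    ← ENNReal.ofReal_mul (Finset.prod_nonneg fun i _ => (G i).le), ← Fin.sum_univ_castSucc,
    Real.one_rpow, mul_one_div]

/-- The powers are absorbed into the density, which turns the moment into the Dirichlet integral
with parameters a + p. -/
lemma lintegral_dirichletMeasure_prod_rpow {k : ℕ} (hk : 0 < k) {a p : Fin k → ℝ}
    (ha : ∀ i, 0 < a i) (hp : ∀ i, 0 < a i + p i) :
    ∫⁻ x, ENNReal.ofReal (∏ i, x i ^ p i) ∂(dirichletMeasure a) =
      ENNReal.ofReal (dirichletMoment a p) := by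
  have : Nonempty (Fin k) := ⟨⟨0, hk⟩⟩
  have hc : 0 < Real.Gamma (∑ i, a i) / ∏ i, Real.Gamma (a i) :=
    div_pos (Real.Gamma_pos_of_pos (Finset.sum_pos (fun i _ => ha i) Finset.univ_nonempty))
      (Finset.prod_pos fun i _ => Real.Gamma_pos_of_pos (ha i))
  rw [dirichletMeasure, lintegral_withDensity_eq_lintegral_mul _ (by fun_prop) (by fun_prop)]
  calc _ = ∫⁻ x, ENNReal.ofReal (Real.Gamma (∑ i, a i) / ∏ i, Real.Gamma (a i)) *
        ENNReal.ofReal (∏ i, x i ^ (a i + p i - 1)) ∂(simplexLebesgue k) := by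
        refine lintegral_congr_ae ?_
        filter_upwards [ae_pos_simplexLebesgue k] with x hx
        have h1 : 0 ≤ ∏ i, x i ^ (a i - 1) :=
          Finset.prod_nonneg fun i _ => Real.rpow_nonneg (hx i).le _
        rw [Pi.mul_apply, ← ENNReal.ofReal_mul (mul_nonneg hc.le h1), ← ENNReal.ofReal_mul hc.le,
          mul_assoc, ← Finset.prod_mul_distrib]
        congr 3
        ext i
        rw [← Real.rpow_add (hx i)]
        ring_nf
    _ = _ := by
        rw [lintegral_const_mul' _ _ ENNReal.ofReal_ne_top,
          lintegral_simplexLebesgue_prod_rpow hk hp, ← ENNReal.ofReal_mul hc.le]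
        congr 1
        rw [dirichletMoment, Finset.prod_div_distrib, Finset.sum_add_distrib]
        ring

lemma isProbabilityMeasure_dirichletMeasure {k : ℕ} (hk : 0 < k) {a : Fin k → ℝ}
    (ha : ∀ i, 0 < a i) : IsProbabilityMeasure (dirichletMeasure a) := by
  have : Nonempty (Fin k) := ⟨⟨0, hk⟩⟩
  have h := lintegral_dirichletMeasure_prod_rpow hk (p := 0) ha (by simpa using ha)
  have h1 := (Real.Gamma_pos_of_pos
    (Finset.sum_pos (fun i _ => ha i) Finset.univ_nonempty)).ne'
  have h2 : ∏ i, Real.Gamma (a i) ≠ 0 :=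
    (Finset.prod_pos fun i _ => Real.Gamma_pos_of_pos (ha i)).ne'
  refine ⟨?_⟩
  simpa [dirichletMoment, h1, h2, Finset.prod_div_distrib] using h

/-! ### Mittag-Leffler laws from their moments -/

/-- The standard exponential distribution. -/
noncomputable def stdExp : Measure ℝ :=
  (volume.restrict (Set.Ioi 0)).withDensity fun x => ENNReal.ofReal (Real.exp (-x))

instance : SFinite stdExp := by unfold stdExp; infer_instance

lemma ae_pos_stdExp : ∀ᵐ x ∂stdExp, 0 < x :=
  withDensity_absolutelyContinuous _ _ (ae_restrict_mem measurableSet_Ioi)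

lemma lintegral_rpow_stdExp {t : ℝ} (ht : -1 < t) :
    ∫⁻ x, ENNReal.ofReal (x ^ t) ∂stdExp = ENNReal.ofReal (Real.Gamma (t + 1)) := by
  rw [stdExp, lintegral_withDensity_eq_lintegral_mul _ (by fun_prop) (by fun_prop),
    Real.Gamma_eq_integral (by linarith), ofReal_integral_eq_lintegral_ofReal
      (Real.GammaIntegral_convergent (by linarith))]
  · refine setLIntegral_congr_fun measurableSet_Ioi fun x hx => ?_
    simp only [Pi.mul_apply]
    rw [← ENNReal.ofReal_mul (Real.exp_pos _).le, add_sub_cancel_right]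
  · filter_upwards [ae_restrict_mem measurableSet_Ioi] with x hx
    have : 0 < x := hx
    positivity

lemma stdExp_Ioi {y : ℝ} (hy : 0 ≤ y) : stdExp (Set.Ioi y) = ENNReal.ofReal (Real.exp (-y)) := by
  rw [stdExp, withDensity_apply _ measurableSet_Ioi, Measure.restrict_restrict measurableSet_Ioi,
    Set.inter_eq_left.2 (Set.Ioi_subset_Ioi hy), ← integral_exp_neg_Ioi,
    ofReal_integral_eq_lintegral_ofReal (integrableOn_exp_neg_Ioi y)
      (Eventually.of_forall fun x => (Real.exp_pos _).le)]

section MittagLeffler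

variable {β θ : ℝ} {ρ : Measure ℝ}

lemma lintegral_rpow_withDensity_rpow (hpos : ∀ᵐ x ∂ρ, 0 < x) (c s : ℝ) :
    ∫⁻ x, ENNReal.ofReal (x ^ s) ∂(ρ.withDensity fun x => ENNReal.ofReal (x ^ c)) =
      ∫⁻ x, ENNReal.ofReal (x ^ (c + s)) ∂ρ := by
  rw [lintegral_withDensity_eq_lintegral_mul _ (by fun_prop) (by fun_prop)]
  refine lintegral_congr_ae ?_
  filter_upwards [hpos] with x hx
  rw [Pi.mul_apply, ← ENNReal.ofReal_mul (by positivity), ← Real.rpow_add hx]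

/-- If `M` has the moments of a Mittag-Leffler variable weighted by `M ^ (-θ / β)` and `e` is an
independent exponential variable, then `e ^ β * M` is exponentially distributed. -/
lemma map_stdExp_prod_eq_smul_stdExp [SFinite ρ] (hβ : 0 < β) (hθ : 0 < θ)
    (hpos : ∀ᵐ x ∂ρ, 0 < x)
    (hmom : ∀ q, -(θ / β) < q →
      ∫⁻ x, ENNReal.ofReal (x ^ q) ∂ρ = ENNReal.ofReal (mittagLefflerMoment β θ q)) :
    (stdExp.prod (ρ.withDensity fun x => ENNReal.ofReal (x ^ (-(θ / β))))).map
        (fun z => z.1 ^ β * z.2) =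
      ENNReal.ofReal (β * Real.Gamma θ / Real.Gamma (θ / β)) • stdExp := by
  have hm : Measurable fun z : ℝ × ℝ => z.1 ^ β * z.2 := by fun_prop
  have hρ' : ∀ᵐ x ∂(ρ.withDensity fun x => ENNReal.ofReal (x ^ (-(θ / β)))), 0 < x :=
    withDensity_absolutelyContinuous _ _ hpos
  have hc : 0 < β * Real.Gamma θ / Real.Gamma (θ / β) :=
    div_pos (mul_pos hβ (Real.Gamma_pos_of_pos hθ)) (Real.Gamma_pos_of_pos (div_pos hθ hβ))
  have hz : ∀ᵐ z ∂(stdExp.prod (ρ.withDensity fun x => ENNReal.ofReal (x ^ (-(θ / β))))),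
      0 < z.1 ∧ 0 < z.2 :=
    (Measure.quasiMeasurePreserving_fst.ae ae_pos_stdExp).and
      (Measure.quasiMeasurePreserving_snd.ae hρ')
  -- Only orders s > 0 are available: under the weight, order s reads off the moment -θ/β + s of ρ,
  -- which is known only above -θ/β.
  have hE : ∀ s ∈ Set.Ioo (0 : ℝ) 1, ∫⁻ x, ENNReal.ofReal (x ^ s)
      ∂(ENNReal.ofReal (β * Real.Gamma θ / Real.Gamma (θ / β)) • stdExp) =
      ENNReal.ofReal (β * Real.Gamma θ / Real.Gamma (θ / β) * Real.Gamma (s + 1)) := by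
    intro s hs
    rw [lintegral_smul_measure, lintegral_rpow_stdExp (by linarith [hs.1]), smul_eq_mul,
      ← ENNReal.ofReal_mul hc.le]
  have hW : ∀ s ∈ Set.Ioo (0 : ℝ) 1, ∫⁻ x, ENNReal.ofReal (x ^ s)
      ∂((stdExp.prod (ρ.withDensity fun x => ENNReal.ofReal (x ^ (-(θ / β))))).map
        (fun z => z.1 ^ β * z.2)) =
      ENNReal.ofReal (β * Real.Gamma θ / Real.Gamma (θ / β) * Real.Gamma (s + 1)) := by
    intro s hs
    have hs0 : 0 < s := hs.1
    rw [lintegral_map (by fun_prop) hm]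
    calc _ = ∫⁻ z, ENNReal.ofReal (z.1 ^ (β * s)) * ENNReal.ofReal (z.2 ^ s)
          ∂(stdExp.prod (ρ.withDensity fun x => ENNReal.ofReal (x ^ (-(θ / β))))) := by
          refine lintegral_congr_ae ?_
          filter_upwards [hz] with z ⟨h1, h2⟩
          rw [← ENNReal.ofReal_mul (by positivity), Real.mul_rpow (by positivity) h2.le,
            ← Real.rpow_mul h1.le]
      _ = _ := by
          rw [lintegral_prod_mul (f := fun x : ℝ => ENNReal.ofReal (x ^ (β * s)))
            (g := fun x : ℝ => ENNReal.ofReal (x ^ s)) (by fun_prop) (by fun_prop),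
            lintegral_rpow_stdExp (by have := mul_pos hβ hs0; linarith),
            lintegral_rpow_withDensity_rpow hpos, hmom _ (by linarith),
            ← ENNReal.ofReal_mul (Real.Gamma_pos_of_pos (by positivity)).le]
          congr 1
          have e1 : θ / β + (-(θ / β) + s) = s := by ring
          have e2 : θ + β * (-(θ / β) + s) = β * s := by field_simp; ring
          rw [mittagLefflerMoment, e1, e2, Real.Gamma_add_one (by positivity),
            Real.Gamma_add_one hs0.ne']
          have := (Real.Gamma_pos_of_pos (mul_pos hβ hs0)).ne'
          field_simp
  refine eq_of_lintegral_rpow_eq ?_ ?_ one_pos (fun s hs => ?_) (fun s hs => ?_)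
  · rw [ae_map_iff hm.aemeasurable measurableSet_Ioi]
    filter_upwards [hz] with z ⟨h1, h2⟩
    positivity
  · exact Measure.ae_smul_measure ae_pos_stdExp _
  · rw [hW s hs]; exact ENNReal.ofReal_ne_top
  · rw [hW s hs, hE s hs]

/-- For an exponential e independent of M, exp(-l M^(-1/β)) is the conditional probability that e >
l M^(-1/β), that is, e^β M > l^β. The integral is therefore a tail of the law of e^β M, which is a
multiple of the exponential law. -/
lemma lintegral_exp_neg_mul_rpow [SFinite ρ] (hβ : 0 < β) (hθ : 0 < θ) (hpos : ∀ᵐ x ∂ρ, 0 < x)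
    (hmom : ∀ q, -(θ / β) < q →
      ∫⁻ x, ENNReal.ofReal (x ^ q) ∂ρ = ENNReal.ofReal (mittagLefflerMoment β θ q))
    {l : ℝ} (hl : 0 ≤ l) :
    ∫⁻ x, ENNReal.ofReal (Real.exp (-(l * x ^ (-(1 / β)))))
        ∂(ρ.withDensity fun x => ENNReal.ofReal (x ^ (-(θ / β)))) =
      ENNReal.ofReal (β * Real.Gamma θ / Real.Gamma (θ / β)) *
        ENNReal.ofReal (Real.exp (-(l ^ β))) := by
  have hm : Measurable fun z : ℝ × ℝ => z.1 ^ β * z.2 := by fun_prop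
  have hlβ : 0 ≤ l ^ β := by positivity
  have key := congrArg (fun M : Measure ℝ => M (Set.Ioi (l ^ β)))
    (map_stdExp_prod_eq_smul_stdExp hβ hθ hpos hmom)
  simp only [Measure.smul_apply, smul_eq_mul] at key
  rw [stdExp_Ioi hlβ, Measure.map_apply hm measurableSet_Ioi,
    Measure.prod_apply_symm (hm measurableSet_Ioi)] at key
  rw [← key]
  have hρ' : ∀ᵐ x ∂(ρ.withDensity fun x => ENNReal.ofReal (x ^ (-(θ / β)))), 0 < x :=
    withDensity_absolutelyContinuous _ _ hpos
  refine lintegral_congr_ae ?_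
  filter_upwards [hρ'] with x hx
  rw [← stdExp_Ioi (by positivity)]
  refine measure_congr ?_
  filter_upwards [ae_pos_stdExp] with e he
  refine propext ?_
  change l * x ^ (-(1 / β)) < e ↔ l ^ β < e ^ β * x
  have hx' : (x ^ (-(1 / β))) ^ β = x⁻¹ := by
    rw [← Real.rpow_mul hx.le, neg_mul, one_div_mul_cancel hβ.ne', Real.rpow_neg_one]
  rw [← Real.rpow_lt_rpow_iff (by positivity) he.le hβ, Real.mul_rpow hl (by positivity), hx',
    ← div_eq_mul_inv, div_lt_iff₀ hx]

/-- The generalized Mittag-Leffler distribution is characterized by its moments. -/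
lemma isMittagLefflerLaw_of_moments [SFinite ρ] (hβ : 0 < β) (hθ : 0 < θ) (hpos : ∀ᵐ x ∂ρ, 0 < x)
    (hmom : ∀ q, -(θ / β) < q →
      ∫⁻ x, ENNReal.ofReal (x ^ q) ∂ρ = ENNReal.ofReal (mittagLefflerMoment β θ q)) :
    IsMittagLefflerLaw β θ ρ := by
  have hg : Measurable fun x : ℝ => x ^ (-(1 / β)) := by fun_prop
  have hc : 0 < β * Real.Gamma θ / Real.Gamma (θ / β) :=
    div_pos (mul_pos hβ (Real.Gamma_pos_of_pos hθ)) (Real.Gamma_pos_of_pos (div_pos hθ hβ))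
  have hL := fun (l : ℝ) (hl : 0 ≤ l) => lintegral_exp_neg_mul_rpow hβ hθ hpos hmom hl
  set c := ENNReal.ofReal (β * Real.Gamma θ / Real.Gamma (θ / β))
  have hc0 : c ≠ 0 := by simpa [c] using hc
  have hct : c ≠ ∞ := ENNReal.ofReal_ne_top
  set ρ' := ρ.withDensity fun x => ENNReal.ofReal (x ^ (-(θ / β))) with hρ'
  have hρ'pos : ∀ᵐ x ∂ρ', 0 < x := withDensity_absolutelyContinuous _ _ hpos
  -- The Laplace transform at l = 0 gives the total mass, the moment of critical order -θ/β that the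
  -- hypothesis leaves out.
  have hmass : ρ' Set.univ = c := by
    simpa [Real.zero_rpow hβ.ne'] using hL 0 le_rfl
  -- If M = σ^(-β) under the law tilted by σ^(-θ), then σ = M^(-1/β) and the tilt is removed by the
  -- weight M^(-θ/β). This dictates the candidate for the stable law.
  set ν := (c⁻¹ • ρ').map fun x => x ^ (-(1 / β)) with hν
  have hνint : ∀ f : ℝ → ℝ≥0∞, Measurable f →
      ∫⁻ y, f y ∂ν = c⁻¹ * ∫⁻ x, f (x ^ (-(1 / β))) ∂ρ' := by
    intro f hf
    rw [hν, lintegral_map hf hg, lintegral_smul_measure, smul_eq_mul]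
  have hML : ∀ f : ℝ → ℝ≥0∞, Measurable f →
      ∫⁻ y, ENNReal.ofReal (y ^ (-θ)) * f (y ^ (-β)) ∂ν = c⁻¹ * ∫⁻ x, f x ∂ρ := by
    intro f hf
    rw [hνint (fun y => ENNReal.ofReal (y ^ (-θ)) * f (y ^ (-β))) (by fun_prop), hρ',
      lintegral_withDensity_eq_lintegral_mul _ (by fun_prop) (by fun_prop)]
    congr 1
    refine lintegral_congr_ae ?_
    filter_upwards [hpos] with x hx
    rw [Pi.mul_apply, ← Real.rpow_mul hx.le, ← Real.rpow_mul hx.le, ← mul_assoc,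
      ← ENNReal.ofReal_mul (by positivity), ← Real.rpow_add hx]
    have e1 : -(θ / β) + -(1 / β) * -θ = 0 := by ring
    have e2 : -(1 / β) * -β = 1 := by field_simp
    rw [e1, e2, Real.rpow_zero, Real.rpow_one, ENNReal.ofReal_one, one_mul]
  have hρ1 : ∫⁻ _, 1 ∂ρ = 1 := by
    have := hmom 0 (by have := div_pos hθ hβ; linarith)
    simpa [mittagLefflerMoment, mul_comm, (Real.Gamma_pos_of_pos hθ).ne',
      (Real.Gamma_pos_of_pos (div_pos hθ hβ)).ne'] using this
  have hνprob : IsProbabilityMeasure ν := by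
    refine ⟨?_⟩
    rw [hν, Measure.map_apply hg MeasurableSet.univ, Set.preimage_univ, Measure.smul_apply, hmass,
      smul_eq_mul, ENNReal.inv_mul_cancel hc0 hct]
  refine ⟨ν, ⟨hνprob, ?_, fun l hl => ?_⟩, fun f hf => ?_⟩
  · rw [hν, ae_map_iff hg.aemeasurable measurableSet_Ici]
    refine Measure.ae_smul_measure ?_ _
    filter_upwards [hρ'pos] with x hx
    positivity
  · rw [integral_eq_lintegral_of_nonneg_ae (Eventually.of_forall fun x => (Real.exp_pos _).le)
      (by fun_prop), hνint _ (by fun_prop), hL l hl, ← mul_assoc,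
      ENNReal.inv_mul_cancel hc0 hct, one_mul, ENNReal.toReal_ofReal (Real.exp_pos _).le]
  · have h1 := hML 1 measurable_one
    simp only [Pi.one_apply, mul_one] at h1
    rw [hML f hf, h1, hρ1, mul_one]
    rw [mul_comm, ENNReal.mul_div_cancel_right (ENNReal.inv_ne_zero.2 hct)
      (ENNReal.inv_ne_top.2 hc0)]

end MittagLeffler

/-! ### The joint law of the limits -/

lemma lintegral_pi_prod_eq_prod_lintegral {ι : Type*} [Fintype ι] {E : ι → Type*}
    [∀ i, MeasurableSpace (E i)] (μ : ∀ i, Measure (E i)) [∀ i, IsProbabilityMeasure (μ i)]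
    {f : ∀ i, E i → ℝ≥0∞} (hf : ∀ i, Measurable (f i)) :
    ∫⁻ x, ∏ i, f i (x i) ∂(Measure.pi μ) = ∏ i, ∫⁻ x, f i x ∂(μ i) := by
  have h := lintegral_prod_eq_prod_lintegral_of_indepFun Finset.univ
    (fun i (x : ∀ i, E i) => f i (x i)) (iIndepFun_pi (μ := μ) fun i => (hf i).aemeasurable)
    fun i => (hf i).comp (measurable_pi_apply i)
  refine h.trans ?_
  refine Finset.prod_congr rfl fun i _ => ?_
  conv_rhs => rw [← (measurePreserving_eval μ i).map_eq]
  rw [lintegral_map (hf i) (measurable_pi_apply i)]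

lemma ae_pos_pi {ι : Type*} [Fintype ι] {μ : ι → Measure ℝ} [∀ i, SigmaFinite (μ i)]
    (h : ∀ i, ∀ᵐ x ∂(μ i), 0 < x) : ∀ᵐ x ∂(Measure.pi μ), ∀ i, 0 < x i := by
  rw [ae_all_iff]
  exact fun i => (Measure.quasiMeasurePreserving_eval μ i).ae (h i)

lemma lintegral_pi_prod_rpow {ι : Type*} [Fintype ι] {μ : ι → Measure ℝ}
    [∀ i, IsProbabilityMeasure (μ i)] (h : ∀ i, ∀ᵐ x ∂(μ i), 0 < x) (s : ι → ℝ) :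
    ∫⁻ x, ENNReal.ofReal (∏ i, x i ^ s i) ∂(Measure.pi μ) =
      ∏ i, ∫⁻ x, ENNReal.ofReal (x ^ s i) ∂(μ i) := by
  rw [← lintegral_pi_prod_eq_prod_lintegral μ
    (f := fun i x => ENNReal.ofReal (x ^ s i)) fun i => by fun_prop]
  refine lintegral_congr_ae ?_
  filter_upwards [ae_pos_pi h] with x hx
  rw [ENNReal.ofReal_prod_of_nonneg fun i _ => Real.rpow_nonneg (hx i).le _]

lemma mittagLefflerMoment_zero {β θ : ℝ} (hβ : 0 < β) (hθ : 0 < θ) :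
    mittagLefflerMoment β θ 0 = 1 := by
  have h1 := (Real.Gamma_pos_of_pos hθ).ne'
  have h2 := (Real.Gamma_pos_of_pos (div_pos hθ hβ)).ne'
  rw [mittagLefflerMoment, add_zero, mul_zero, add_zero]
  field_simp

lemma dirichletMoment_zero {k : ℕ} (hk : 0 < k) {a : Fin k → ℝ} (ha : ∀ i, 0 < a i) :
    dirichletMoment a 0 = 1 := by
  have : Nonempty (Fin k) := ⟨⟨0, hk⟩⟩
  have h1 := (Real.Gamma_pos_of_pos
    (Finset.sum_pos (fun i _ => ha i) Finset.univ_nonempty)).ne'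
  have h2 := fun i => (Real.Gamma_pos_of_pos (ha i)).ne'
  simp [dirichletMoment, h1, h2]

/-- Of the three admissibility bounds the one on p is the tightest, so a single bound serves all
exponents. -/
lemma div_le_self_and_le_div_sub_one {α : ℝ} (hα₁ : 1 < α) (hα₂ : α < 2) {g : ℝ} (hg : 0 < g) :
    g / α ≤ g ∧ g ≤ g / (α - 1) := by
  constructor
  · exact div_le_self hg.le hα₁.le
  · rw [le_div_iff₀ (by linarith)]
    nlinarith

namespace IsThreeTypeUrn

variable {Ω : Type*} [m : MeasurableSpace Ω] {k : ℕ} {α : ℝ} {γ : Fin k → ℝ}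
    {μ : Measure Ω} [IsProbabilityMeasure μ] {ℱ : Filtration ℕ m}
    {draw : ℕ → Ω → Fin k × UrnType}
    {X : ℕ → Ω → Fin k → UrnType → ℝ} {D R Rbar : Ω → Fin k → ℝ}

/-- The joint moment with a single nonzero exponent; all other moment factors are 1. -/
lemma lintegral_rpow_snd_limit (hX : IsThreeTypeUrn α γ μ ℱ draw X) (hk : 0 < k)
    (hα : 1 < α) (hγ : ∀ i, 0 < γ i)
    (hlim : ∀ᵐ ω ∂μ, ∀ i, HasCountLimits α (fun n => drawCounts draw n ω i) (D ω i) (R ω i)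
      (Rbar ω i)) (i : Fin k) {q : ℝ} (hq : -γ i < q) :
    ∫⁻ ω, ENNReal.ofReal (R ω i ^ q) ∂μ =
      ENNReal.ofReal (mittagLefflerMoment (1 / α) (γ i / α) q) := by
  have h1 : 0 < α - 1 := by linarith
  have hga : ∀ j, 0 < γ j / α := fun j => div_pos (hγ j) (by linarith)
  have h := hX.lintegral_prod_limits hk hα hγ hlim (p := 0) (q := Pi.single i q) (r := 0)
    fun j => ⟨by simpa using hga j, by
      by_cases hj : j = i
      · subst hj; simp; linarith
      · simpa [hj] using hγ j, by simpa using div_pos (hγ j) h1⟩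
  rw [dirichletMoment_zero hk hga, Finset.prod_eq_single i, Finset.prod_eq_one (s := Finset.univ)]
    at h
  · simp only [Pi.single_eq_same, one_mul, mul_one] at h
    rw [← h]
    refine lintegral_congr fun ω => ?_
    rw [Finset.prod_eq_single i]
    · simp
    · intro j _ hj; simp [hj]
    · simp
  · intro j _; exact mittagLefflerMoment_zero h1 (hγ j)
  · intro j _ hj
    rw [Pi.single_eq_of_ne hj]
    exact mittagLefflerMoment_zero (by positivity) (hga j)
  · simp

lemma lintegral_rpow_trd_limit (hX : IsThreeTypeUrn α γ μ ℱ draw X) (hk : 0 < k)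
    (hα : 1 < α) (hγ : ∀ i, 0 < γ i)
    (hlim : ∀ᵐ ω ∂μ, ∀ i, HasCountLimits α (fun n => drawCounts draw n ω i) (D ω i) (R ω i)
      (Rbar ω i)) (i : Fin k) {r : ℝ} (hr : -(γ i / (α - 1)) < r) :
    ∫⁻ ω, ENNReal.ofReal (Rbar ω i ^ r) ∂μ =
      ENNReal.ofReal (mittagLefflerMoment (α - 1) (γ i) r) := by
  have h1 : 0 < α - 1 := by linarith
  have hga : ∀ j, 0 < γ j / α := fun j => div_pos (hγ j) (by linarith)
  have h := hX.lintegral_prod_limits hk hα hγ hlim (p := 0) (q := 0) (r := Pi.single i r)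
    fun j => ⟨by simpa using hga j, by simpa using hγ j, by
      by_cases hj : j = i
      · subst hj; simp; linarith
      · simpa [hj] using div_pos (hγ j) h1⟩
  rw [dirichletMoment_zero hk hga, Finset.prod_eq_one (s := Finset.univ), Finset.prod_eq_single i]
    at h
  · simp only [Pi.single_eq_same, one_mul] at h
    rw [← h]
    refine lintegral_congr fun ω => ?_
    rw [Finset.prod_eq_single i]
    · simp
    · intro j _ hj; simp [hj]
    · simp
  · intro j _ hj
    rw [Pi.single_eq_of_ne hj]
    exact mittagLefflerMoment_zero h1 (hγ j)
  · simp
  · intro j _; exact mittagLefflerMoment_zero (by positivity) (hga j)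

/-- The joint law of the limits of the draw counts. -/
lemma map_limits_eq_pi (hX : IsThreeTypeUrn α γ μ ℱ draw X) (hk : 0 < k)
    (hα : 1 < α) (hα₂ : α < 2) (hγ : ∀ i, 0 < γ i) (hD : Measurable D) (hR : Measurable R)
    (hRbar : Measurable Rbar)
    (hlim : ∀ᵐ ω ∂μ, ∀ i, HasCountLimits α (fun n => drawCounts draw n ω i) (D ω i) (R ω i)
      (Rbar ω i)) :
    μ.map (fun ω j => ![D, R, Rbar] j ω) =
      Measure.pi ![dirichletMeasure fun i => γ i / α, Measure.pi fun i => μ.map fun ω => R ω i,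
        Measure.pi fun i => μ.map fun ω => Rbar ω i] := by
  have h1 : 0 < α - 1 := by linarith
  have hga : ∀ i, 0 < γ i / α := fun i => div_pos (hγ i) (by linarith)
  have hRi : ∀ i, Measurable fun ω => R ω i := fun i => (measurable_pi_apply i).comp hR
  have hRbari : ∀ i, Measurable fun ω => Rbar ω i := fun i => (measurable_pi_apply i).comp hRbar
  have : IsProbabilityMeasure (dirichletMeasure fun i => γ i / α) :=
    isProbabilityMeasure_dirichletMeasure hk hga
  have : ∀ i, IsProbabilityMeasure (μ.map fun ω => R ω i) := fun i =>
    Measure.isProbabilityMeasure_map (hRi i).aemeasurable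
  have : ∀ i, IsProbabilityMeasure (μ.map fun ω => Rbar ω i) := fun i =>
    Measure.isProbabilityMeasure_map (hRbari i).aemeasurable
  have hRpos : ∀ i, ∀ᵐ x ∂(μ.map fun ω => R ω i), 0 < x := fun i => by
    rw [ae_map_iff (hRi i).aemeasurable measurableSet_Ioi]
    filter_upwards [hlim] with ω hω using (hω i).snd_pos
  have hRbarpos : ∀ i, ∀ᵐ x ∂(μ.map fun ω => Rbar ω i), 0 < x := fun i => by
    rw [ae_map_iff (hRbari i).aemeasurable measurableSet_Ioi]
    filter_upwards [hlim] with ω hω using (hω i).trd_pos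
  -- The second and third factors are built from the marginals of R and R̄ themselves, so that the
  -- equality with Q expresses independence; the marginals are identified separately.
  set Q : Fin 3 → Measure (Fin k → ℝ) := ![dirichletMeasure fun i => γ i / α,
    Measure.pi fun i => μ.map fun ω => R ω i, Measure.pi fun i => μ.map fun ω => Rbar ω i] with hQ
  have hQp : ∀ j, IsProbabilityMeasure (Q j) := by
    intro j; fin_cases j <;> simp only [hQ] <;> dsimp <;> infer_instance
  have hJ : Measurable fun ω j => ![D, R, Rbar] j ω := by
    refine measurable_pi_lambda _ fun j => ?_
    fin_cases j <;> assumption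
  have hZ : Measurable fun (v : Fin 3 → Fin k → ℝ) (a : Fin 3 × Fin k) => v a.1 a.2 := by fun_prop
  have hposQ : ∀ j, ∀ᵐ x ∂(Q j), ∀ i, 0 < x i := by
    intro j
    fin_cases j
    · exact ae_pos_dirichletMeasure _
    · exact ae_pos_pi hRpos
    · exact ae_pos_pi hRbarpos
  have hposQ' : ∀ᵐ v ∂(Measure.pi Q), ∀ j i, 0 < v j i := by
    rw [ae_all_iff]
    exact fun j => (Measure.quasiMeasurePreserving_eval Q j).ae (hposQ j)
  have : Nonempty (Fin k) := ⟨⟨0, hk⟩⟩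
  -- The smallest γ i / α is a radius within which exponents are admissible for all colours at once.
  obtain ⟨i₀, hi₀⟩ := Finite.exists_min fun i => γ i / α
  have hadm : ∀ t : Fin 3 × Fin k → ℝ, (∀ a, |t a| < γ i₀ / α) → ∀ i,
      AdmissibleExponents α (γ i) (t (0, i)) (t (1, i)) (t (2, i)) := by
    intro t ht i
    obtain ⟨a1, a2⟩ := div_le_self_and_le_div_sub_one hα hα₂ (hγ i)
    have b0 := hi₀ i
    have c0 := (abs_lt.1 (ht (0, i))).1
    have c1 := (abs_lt.1 (ht (1, i))).1
    have c2 := (abs_lt.1 (ht (2, i))).1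
    exact ⟨by linarith, by linarith, by linarith⟩
  have hmomY : ∀ t : Fin 3 × Fin k → ℝ, (∀ a, |t a| < γ i₀ / α) →
      ∫⁻ ω, ENNReal.ofReal (∏ a : Fin 3 × Fin k, ![D, R, Rbar] a.1 ω a.2 ^ t a) ∂μ =
      ENNReal.ofReal (dirichletMoment (fun i => γ i / α) (fun i => t (0, i)) *
        (∏ i, mittagLefflerMoment (1 / α) (γ i / α) (t (1, i))) *
        ∏ i, mittagLefflerMoment (α - 1) (γ i) (t (2, i))) := by
    intro t ht
    rw [← hX.lintegral_prod_limits hk hα hγ hlim (hadm t ht)]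
    refine lintegral_congr fun ω => ?_
    rw [Fintype.prod_prod_type, Fin.prod_univ_three, Finset.prod_mul_distrib,
      Finset.prod_mul_distrib]
    rfl
  have hmomQ : ∀ t : Fin 3 × Fin k → ℝ, (∀ a, |t a| < γ i₀ / α) →
      ∫⁻ v, ENNReal.ofReal (∏ a : Fin 3 × Fin k, v a.1 a.2 ^ t a) ∂(Measure.pi Q) =
      ENNReal.ofReal (dirichletMoment (fun i => γ i / α) (fun i => t (0, i)) *
        (∏ i, mittagLefflerMoment (1 / α) (γ i / α) (t (1, i))) *
        ∏ i, mittagLefflerMoment (α - 1) (γ i) (t (2, i))) := by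
    intro t ht
    have ha := hadm t ht
    have h2 : ∀ i, 0 < mittagLefflerMoment (1 / α) (γ i / α) (t (1, i)) := fun i =>
      (ha i).mittagLefflerMoment_snd_pos hα (hγ i)
    have h3 : ∀ i, 0 < mittagLefflerMoment (α - 1) (γ i) (t (2, i)) := fun i =>
      (ha i).mittagLefflerMoment_trd_pos hα (hγ i)
    have hd := dirichletMoment_pos hk hga fun i => (ha i).fst
    calc _ = ∫⁻ v, ∏ j, ENNReal.ofReal (∏ i, v j i ^ t (j, i)) ∂(Measure.pi Q) := by
          refine lintegral_congr_ae ?_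
          filter_upwards [hposQ'] with v hv
          rw [Fintype.prod_prod_type, ENNReal.ofReal_prod_of_nonneg fun j _ =>
            Finset.prod_nonneg fun i _ => Real.rpow_nonneg (hv j i).le _]
      _ = ∏ j, ∫⁻ x, ENNReal.ofReal (∏ i, x i ^ t (j, i)) ∂(Q j) :=
          lintegral_pi_prod_eq_prod_lintegral Q
            (f := fun j x => ENNReal.ofReal (∏ i, x i ^ t (j, i))) fun j => by fun_prop
      _ = ENNReal.ofReal (dirichletMoment (fun i => γ i / α) fun i => t (0, i)) *
            (∏ i, ENNReal.ofReal (mittagLefflerMoment (1 / α) (γ i / α) (t (1, i)))) *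
            ∏ i, ENNReal.ofReal (mittagLefflerMoment (α - 1) (γ i) (t (2, i))) := by
          rw [Fin.prod_univ_three]
          congr 1
          · congr 1
            · exact lintegral_dirichletMeasure_prod_rpow hk hga fun i => (ha i).fst
            · refine (lintegral_pi_prod_rpow hRpos _).trans (Finset.prod_congr rfl fun i _ => ?_)
              rw [lintegral_map (by fun_prop) (hRi i),
                hX.lintegral_rpow_snd_limit hk hα hγ hlim i (by linarith [(ha i).snd])]
          · refine (lintegral_pi_prod_rpow hRbarpos _).trans
              (Finset.prod_congr rfl fun i _ => ?_)
            rw [lintegral_map (by fun_prop) (hRbari i),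
              hX.lintegral_rpow_trd_limit hk hα hγ hlim i (by linarith [(ha i).trd])]
      _ = _ := by
          rw [← ENNReal.ofReal_prod_of_nonneg fun i _ => (h2 i).le,
            ← ENNReal.ofReal_prod_of_nonneg fun i _ => (h3 i).le, ← ENNReal.ofReal_mul hd.le,
            ← ENNReal.ofReal_mul (mul_nonneg hd.le (Finset.prod_nonneg fun i _ => (h2 i).le))]
  have hY : Measurable fun ω (a : Fin 3 × Fin k) => ![D, R, Rbar] a.1 ω a.2 := hZ.comp hJ
  have hcurry : Measurable fun (v : Fin 3 × Fin k → ℝ) j i => v (j, i) := by fun_prop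
  have key := map_eq_map_of_lintegral_prod_rpow_eq (P := μ) (Q := Measure.pi Q)
    (Y := fun ω (a : Fin 3 × Fin k) => ![D, R, Rbar] a.1 ω a.2)
    (Z := fun v (a : Fin 3 × Fin k) => v a.1 a.2) hY hZ ?_ ?_ (hga i₀)
    (fun t ht => by rw [hmomY t ht]; exact ENNReal.ofReal_ne_top)
    (fun t ht => by rw [hmomY t ht, hmomQ t ht])
  · have key' := congrArg (Measure.map fun (v : Fin 3 × Fin k → ℝ) j i => v (j, i)) key
    rw [Measure.map_map hcurry hY, Measure.map_map hcurry hZ] at key'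
    simp only [Function.comp_def, Measure.map_id'] at key'
    exact key'
  · filter_upwards [hlim] with ω hω ⟨j, i⟩
    fin_cases j
    · exact (hω i).fst_pos
    · exact (hω i).snd_pos
    · exact (hω i).trd_pos
  · filter_upwards [hposQ'] with v hv a using hv a.1 a.2

end IsThreeTypeUrn

/-! ### Asymptotics of the weights and conclusion -/

/-- Compose the scales: K / n^(1/α) = (N/n)^(1/α) · K / N^(1/α) and J / n^(1-1/α) = (K /
n^(1/α))^(α-1) · J / K^(α-1), where (α - 1)/α = 1 - 1/α. -/
lemma HasCountLimits.tendsto_trd_div_rpow {α x y z : ℝ} {s : ℕ → ℕ × ℕ × ℕ} (hα : 1 < α)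
    (h : HasCountLimits α s x y z) :
    Tendsto (fun n : ℕ => ((s n).2.1 : ℝ) / (n : ℝ) ^ (1 / α)) atTop (𝓝 (x ^ (1 / α) * y)) ∧
    Tendsto (fun n : ℕ => ((s n).2.2 : ℝ) / (n : ℝ) ^ (1 - 1 / α)) atTop
      (𝓝 (x ^ (1 - 1 / α) * y ^ (α - 1) * z)) := by
  have hN : Tendsto (fun n => ((s n).1 : ℝ)) atTop atTop :=
    tendsto_natCast_atTop_atTop.comp h.fst_atTop
  have hK : Tendsto (fun n => ((s n).2.1 : ℝ)) atTop atTop :=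
    tendsto_natCast_atTop_atTop.comp h.snd_atTop
  have h1 : Tendsto (fun n : ℕ => ((s n).2.1 : ℝ) / (n : ℝ) ^ (1 / α)) atTop
      (𝓝 (x ^ (1 / α) * y)) := by
    refine ((h.fst.rpow_const (p := 1 / α) (Or.inl h.fst_pos.ne')).mul h.snd).congr' ?_
    filter_upwards [hN.eventually_gt_atTop 0, eventually_gt_atTop 0] with n h1 h2
    rw [Real.div_rpow h1.le (by positivity)]
    have := (Real.rpow_pos_of_pos h1 (1 / α)).ne'
    field_simp
  refine ⟨h1, ?_⟩
  have hne : x ^ (1 / α) * y ≠ 0 := (mul_pos (Real.rpow_pos_of_pos h.fst_pos _) h.snd_pos).ne'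
  have h2 := (h1.rpow_const (p := α - 1) (Or.inl hne)).mul h.trd
  have e1 : (1 / α) * (α - 1) = 1 - 1 / α := by field_simp
  rw [Real.mul_rpow (Real.rpow_pos_of_pos h.fst_pos _).le h.snd_pos.le,
    ← Real.rpow_mul h.fst_pos.le, e1] at h2
  refine h2.congr' ?_
  filter_upwards [hK.eventually_gt_atTop 0, eventually_gt_atTop 0] with n h1 h2
  rw [Real.div_rpow h1.le (by positivity), ← Real.rpow_mul (by positivity), e1]
  have := (Real.rpow_pos_of_pos h1 (α - 1)).ne'
  field_simp

/-- The asymptotics of the weights of a colour. -/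
lemma HasCountLimits.tendsto_colourWeight {α g x y z : ℝ} {s : ℕ → ℕ × ℕ × ℕ} (hα₁ : 1 < α)
    (hα₂ : α < 2) (h : HasCountLimits α s x y z) :
    Tendsto (fun n : ℕ => 1 / ((α - 1) * (n : ℝ) ^ (1 - 1 / α)) * colourWeight α g (s n) .a) atTop
        (𝓝 (x ^ (1 - 1 / α) * y ^ (α - 1) * z)) ∧
      Tendsto (fun n : ℕ => 1 / (n : ℝ) ^ (1 / α) * colourWeight α g (s n) .b) atTop
        (𝓝 (x ^ (1 / α) * y)) ∧
      Tendsto (fun n : ℕ => 1 / (α * (n : ℝ)) * colourWeight α g (s n) .c) atTop (𝓝 x) := by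
  obtain ⟨hK, hJ⟩ := h.tendsto_trd_div_rpow hα₁
  have hα0 : 0 < α - 1 := by linarith
  have hlt : 1 / α < 1 := by rw [div_lt_one] <;> linarith
  have hgt : 1 / 2 < 1 / α := one_div_lt_one_div_of_lt (by linarith) hα₂
  have hpow : ∀ e : ℝ, 0 < e → Tendsto (fun n : ℕ => 1 / (n : ℝ) ^ e) atTop (𝓝 0) := fun e he =>
    tendsto_const_nhds.div_atTop ((tendsto_rpow_atTop he).comp tendsto_natCast_atTop_atTop)
  refine ⟨?_, ?_, ?_⟩
  · have t := ((hpow (1 - 1 / α) (by linarith)).const_mul (g / (α - 1))).add hJ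
    rw [mul_zero, zero_add] at t
    refine t.congr fun n => ?_
    simp only [colourWeight]
    field_simp
  -- The correction from J is of order n^(1-1/α), negligible against n^(1/α) because 2/α > 1; this
  -- is where α < 2 enters.
  · have t := hK.sub ((hJ.mul (hpow (2 * (1 / α) - 1) (by linarith))).const_mul (α - 1))
    rw [mul_zero, mul_zero, sub_zero] at t
    refine t.congr' ?_
    filter_upwards [eventually_gt_atTop 0] with n hn
    have hn' : (0 : ℝ) < n := by exact_mod_cast hn
    simp only [colourWeight]
    have e : (n : ℝ) ^ (1 / α) = (n : ℝ) ^ (1 - 1 / α) * (n : ℝ) ^ (2 * (1 / α) - 1) := by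
      rw [← Real.rpow_add hn']; ring_nf
    rw [e]
    field_simp
  -- Here K is of order n^(1/α), negligible against n.
  · have t := h.fst.sub ((hK.mul (hpow (1 - 1 / α) (by linarith))).const_mul (1 / α))
    rw [mul_zero, mul_zero, sub_zero] at t
    refine t.congr' ?_
    filter_upwards [eventually_gt_atTop 0] with n hn
    have hn' : (0 : ℝ) < n := by exact_mod_cast hn
    simp only [colourWeight]
    have e : (n : ℝ) ^ (1 / α) * (n : ℝ) ^ (1 - 1 / α) = n := by
      rw [← Real.rpow_add hn']; simp
    rw [div_mul_div_comm, mul_one, e]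
    field_simp

theorem proposition2p3 {Ω : Type*} [m : MeasurableSpace Ω] (μ : Measure Ω) [IsProbabilityMeasure μ]
    (k : ℕ) (hk : 0 < k) (α : ℝ) (hα₁ : 1 < α) (hα₂ : α < 2)
    (γ : Fin k → ℝ) (hγ : ∀ i, 0 < γ i)
    (ℱ : Filtration ℕ m) (draw : ℕ → Ω → Fin k × UrnType) (X : ℕ → Ω → Fin k → UrnType → ℝ)
    (hX : IsThreeTypeUrn α γ μ ℱ draw X) :
    ∃ D R Rbar : Ω → Fin k → ℝ,
      Measurable D ∧ Measurable R ∧ Measurable Rbar ∧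
      iIndepFun ![D, R, Rbar] μ ∧
      μ.map D = dirichletMeasure (fun i => γ i / α) ∧
      iIndepFun (fun i ω => R ω i) μ ∧
      (∀ i, IsMittagLefflerLaw (1 / α) (γ i / α) (μ.map fun ω => R ω i)) ∧
      iIndepFun (fun i ω => Rbar ω i) μ ∧
      (∀ i, IsMittagLefflerLaw (α - 1) (γ i) (μ.map fun ω => Rbar ω i)) ∧
      ∀ᵐ ω ∂μ,
        Tendsto (fun (n : ℕ) i => 1 / ((α - 1) * (n : ℝ) ^ (1 - 1 / α)) * X n ω i .a) atTop
          (𝓝 fun i => D ω i ^ (1 - 1 / α) * R ω i ^ (α - 1) * Rbar ω i) ∧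
        Tendsto (fun (n : ℕ) i => 1 / (n : ℝ) ^ (1 / α) * X n ω i .b) atTop
          (𝓝 fun i => D ω i ^ (1 / α) * R ω i) ∧
        Tendsto (fun (n : ℕ) i => 1 / (α * (n : ℝ)) * X n ω i .c) atTop
          (𝓝 fun i => D ω i) := by
  obtain ⟨D, R, Rbar, hD, hR, hRbar, hlim⟩ := hX.exists_measurable_limits hk hα₁ hγ
  have hα0 : 0 < α - 1 := by linarith
  have hRi : ∀ i, Measurable fun ω => R ω i := fun i => (measurable_pi_apply i).comp hR
  have hRbari : ∀ i, Measurable fun ω => Rbar ω i := fun i => (measurable_pi_apply i).comp hRbar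
  have : IsProbabilityMeasure (dirichletMeasure fun i => γ i / α) :=
    isProbabilityMeasure_dirichletMeasure hk fun i => div_pos (hγ i) (by linarith)
  have : ∀ i, IsProbabilityMeasure (μ.map fun ω => R ω i) := fun i =>
    Measure.isProbabilityMeasure_map (hRi i).aemeasurable
  have : ∀ i, IsProbabilityMeasure (μ.map fun ω => Rbar ω i) := fun i =>
    Measure.isProbabilityMeasure_map (hRbari i).aemeasurable
  have hjoint := hX.map_limits_eq_pi hk hα₁ hα₂ hγ hD hR hRbar hlim
  set Q : Fin 3 → Measure (Fin k → ℝ) := ![dirichletMeasure fun i => γ i / α,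
    Measure.pi fun i => μ.map fun ω => R ω i, Measure.pi fun i => μ.map fun ω => Rbar ω i] with hQ
  have hQp : ∀ j, IsProbabilityMeasure (Q j) := by
    intro j; fin_cases j <;> simp only [hQ] <;> dsimp <;> infer_instance
  have hm : ∀ j, Measurable (![D, R, Rbar] j) := by intro j; fin_cases j <;> assumption
  -- The marginals of the product law give the law of D and the independence within R and within R̄.
  have hmarg : ∀ j, μ.map (![D, R, Rbar] j) = Q j := by
    intro j
    rw [← (measurePreserving_eval Q j).map_eq, ← hjoint,
      Measure.map_map (measurable_pi_apply j) (measurable_pi_lambda _ hm)]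
    rfl
  refine ⟨D, R, Rbar, hD, hR, hRbar, ?_, hmarg 0, ?_, fun i => ?_, ?_, fun i => ?_, ?_⟩
  · rw [iIndepFun_iff_map_fun_eq_pi_map fun j => (hm j).aemeasurable]
    simp only [hmarg]
    exact hjoint
  · rw [iIndepFun_iff_map_fun_eq_pi_map fun i => (hRi i).aemeasurable]
    exact hmarg 1
  · refine isMittagLefflerLaw_of_moments (by positivity) (div_pos (hγ i) (by linarith)) ?_
      fun q hq => ?_
    · rw [ae_map_iff (hRi i).aemeasurable measurableSet_Ioi]
      filter_upwards [hlim] with ω hω using (hω i).snd_pos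
    · rw [lintegral_map (by fun_prop) (hRi i)]
      refine hX.lintegral_rpow_snd_limit hk hα₁ hγ hlim i ?_
      have : γ i / α / (1 / α) = γ i := by field_simp
      rwa [this] at hq
  · rw [iIndepFun_iff_map_fun_eq_pi_map fun i => (hRbari i).aemeasurable]
    exact hmarg 2
  · refine isMittagLefflerLaw_of_moments hα0 (hγ i) ?_ fun q hq => ?_
    · rw [ae_map_iff (hRbari i).aemeasurable measurableSet_Ioi]
      filter_upwards [hlim] with ω hω using (hω i).trd_pos
    · rw [lintegral_map (by fun_prop) (hRbari i)]
      exact hX.lintegral_rpow_trd_limit hk hα₁ hγ hlim i hq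
  · filter_upwards [hlim] with ω hω
    simp only [hX.eq_colourWeight, tendsto_pi_nhds]
    have h := fun i => (hω i).tendsto_colourWeight (g := γ i) hα₁ hα₂
    exact ⟨fun i => (h i).1, fun i => (h i).2.1, fun i => (h i).2.2⟩
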